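/- Let $0<r<1$. Let $\mathbb T$ be the unit circle with normalized Lebesgue measure $\frac{dt}{2\pi}$, and let $L^r(\mathbb T)$ be the space of (classes of) measurable functions $f:\mathbb T\to\mathbb C$ with $\int|f|^r<\infty$, with the metric $d(f,g)=\frac1{2\pi}\int_0^{2\pi}|f(e^{it})-g(e^{it})|^r\,dt$. Let $H^r(\mathbb D)$ be the space of holomorphic functions $F$ on the open unit disc with $\sup_{0\le R<1}\frac1{2\pi}\int_0^{2\pi}|F(Re^{it})|^r\,dt<\infty$, and let $H^r(\mathbb T)\subset L^r(\mathbb T)$ be the linear space of all boundary functions $f(e^{it})=\lim_{R\to1^-}F(Re^{it})$ (for a.e. $t$) of functions $F\in H^r(\mathbb D)$. Let $\alpha\in\mathbb R$ with $\alpha/2\pi$ irrational, and let $Tf(e^{it})=f(e^{i(t+\alpha)})$ be the operator on $L^r(\mathbb T)$ induced by the rotation by the angle $\alpha$. Denote by $\mathcal C$ the subspace of constant functions, and let closures be taken in $L^r(\mathbb T)$ with respect to the metric $d$. Then $$H^r(\mathbb T)=\mathcal C\oplus\overline{(I-T)H^r(\mathbb T)},$$ that is, $H^r(\mathbb T)=\mathcal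 C+\overline{(I-T)H^r(\mathbb T)}$ and $\mathcal C\cap\overline{(I-T)H^r(\mathbb T)}=\{0\}$. In particular the constant function $\mathbf 1$ does not belong to $\overline{(I-T)H^r(\mathbb T)}$, whereas $\mathbf 1\in\overline{(I-T)L^r(\mathbb T)}$ if $r<\frac13$. -/

import Mathlib

open MeasureTheory Filter Topology

noncomputable section

namespace HardyRotation

instance factTwoPiPos : Fact (0 < 2 * Real.pi) := ⟨Real.two_pi_pos⟩

/-- The circle `𝕋 = ℝ / 2πℤ`; its point `t` stands for `e^{it}` (`AddCircle.toCircle t`). -/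
abbrev Torus : Type := AddCircle (2 * Real.pi)

/-- Normalized Lebesgue measure `dt / 2π` on the circle. -/
abbrev mes : Measure Torus := AddCircle.haarAddCircle

/-- The complex space `L^r(𝕋)`, functions being identified when they agree almost everywhere. -/
abbrev Lr (r : ℝ) : Type := Lp ℂ (ENNReal.ofReal r) mes

/-- The metric `d(f,g) = ∫ |f - g|^r` of `L^r(𝕋)`, `0 < r < 1`. -/
def lrDist (r : ℝ) (f g : Lr r) : ℝ := ∫ t, ‖f t - g t‖ ^ r ∂mes

theorem integrable_norm_rpow {r : ℝ} (hr : 0 < r) (f : Lr r) :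
    Integrable (fun t => ‖f t‖ ^ r) mes := by
  have h := (Lp.memLp f).integrable_norm_rpow'
  rwa [ENNReal.toReal_ofReal hr.le] at h

theorem integrable_norm_sub_rpow {r : ℝ} (hr : 0 < r) (f g : Lr r) :
    Integrable (fun t => ‖f t - g t‖ ^ r) mes := by
  refine (integrable_norm_rpow hr (f - g)).congr ?_
  filter_upwards [Lp.coeFn_sub f g] with t ht
  rw [ht, Pi.sub_apply]

theorem norm_add_rpow_le {r : ℝ} (hr : 0 < r) (hr1 : r < 1) (a b : ℂ) :
    ‖a + b‖ ^ r ≤ ‖a‖ ^ r + ‖b‖ ^ r :=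
  (Real.rpow_le_rpow (norm_nonneg _) (norm_add_le a b) hr.le).trans
    (Real.rpow_add_le_add_rpow (norm_nonneg _) (norm_nonneg _) hr.le hr1.le)

theorem lrDist_add_le {r : ℝ} (hr : 0 < r) (hr1 : r < 1) (f₁ f₂ g₁ g₂ : Lr r) :
    lrDist r (f₁ + f₂) (g₁ + g₂) ≤ lrDist r f₁ g₁ + lrDist r f₂ g₂ := by
  unfold lrDist
  rw [← integral_add (integrable_norm_sub_rpow hr _ _) (integrable_norm_sub_rpow hr _ _)]
  refine integral_mono_ae (integrable_norm_sub_rpow hr _ _)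
    ((integrable_norm_sub_rpow hr _ _).add (integrable_norm_sub_rpow hr _ _)) ?_
  filter_upwards [Lp.coeFn_add f₁ f₂, Lp.coeFn_add g₁ g₂] with t h₁ h₂
  simp only [h₁, h₂, Pi.add_apply]
  rw [add_sub_add_comm]
  exact norm_add_rpow_le hr hr1 _ _

theorem lrDist_smul (r : ℝ) (c : ℂ) (f g : Lr r) :
    lrDist r (c • f) (c • g) = ‖c‖ ^ r * lrDist r f g := by
  unfold lrDist
  rw [← integral_const_mul]
  refine integral_congr_ae ?_
  filter_upwards [Lp.coeFn_smul c f, Lp.coeFn_smul c g] with t h₁ h₂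
  simp only [h₁, h₂, Pi.smul_apply]
  rw [← smul_sub, norm_smul, Real.mul_rpow (norm_nonneg _) (norm_nonneg _)]

/-- The closure of a linear subspace of `L^r(𝕋)` in the metric `lrDist r`. -/
def lrClosure {r : ℝ} (hr : 0 < r) (hr1 : r < 1) (W : Submodule ℂ (Lr r)) :
    Submodule ℂ (Lr r) where
  carrier := {f | ∀ ε > 0, ∃ g ∈ W, lrDist r f g < ε}
  zero_mem' := by
    intro ε hε
    refine ⟨0, W.zero_mem, ?_⟩
    have : lrDist r (0 : Lr r) 0 = 0 := by simp [lrDist, Real.zero_rpow hr.ne']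
    rwa [this]
  add_mem' := by
    intro f₁ f₂ h₁ h₂ ε hε
    obtain ⟨g₁, hg₁, d₁⟩ := h₁ (ε / 2) (half_pos hε)
    obtain ⟨g₂, hg₂, d₂⟩ := h₂ (ε / 2) (half_pos hε)
    exact ⟨g₁ + g₂, W.add_mem hg₁ hg₂,
      (lrDist_add_le hr hr1 f₁ f₂ g₁ g₂).trans_lt (by linarith)⟩
  smul_mem' := by
    intro c f h ε hε
    have hc : 0 ≤ ‖c‖ ^ r := Real.rpow_nonneg (norm_nonneg c) r
    obtain ⟨g, hg, d⟩ := h (ε / (‖c‖ ^ r + 1)) (by positivity)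
    refine ⟨c • g, W.smul_mem c hg, ?_⟩
    rw [lrDist_smul]
    rw [lt_div_iff₀ (by positivity)] at d
    have h0 : 0 ≤ lrDist r f g := integral_nonneg fun t => Real.rpow_nonneg (norm_nonneg _) r
    nlinarith

/-- The Hardy space `H^r(𝔻)` of the open unit disc: `f` is holomorphic in the disc and the means
`(1/2π) ∫₀^{2π} |f(R e^{it})|^r dt`, `0 ≤ R < 1`, are bounded. Only the values of `f` in the disc
matter. -/
def MemHardyDisc (r : ℝ) (f : ℂ → ℂ) : Prop :=
  DifferentiableOn ℂ f (Metric.ball 0 1) ∧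
    BddAbove ((fun R : ℝ => Real.circleAverage (fun z => ‖f z‖ ^ r) 0 R) '' Set.Ico 0 1)

theorem circleIntegrable_norm_rpow {r : ℝ} (hr : 0 < r) {f : ℂ → ℂ}
    (hf : DifferentiableOn ℂ f (Metric.ball 0 1)) {R : ℝ} (hR : R ∈ Set.Ico (0 : ℝ) 1) :
    CircleIntegrable (fun z => ‖f z‖ ^ r) 0 R := by
  refine ContinuousOn.circleIntegrable hR.1 ?_
  refine (hf.continuousOn.mono fun z hz => ?_).norm.rpow_const fun _ _ => Or.inr hr.le
  rw [mem_sphere_zero_iff_norm] at hz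
  rw [mem_ball_zero_iff, hz]
  exact hR.2

theorem MemHardyDisc.zero {r : ℝ} (hr : 0 < r) : MemHardyDisc r 0 := by
  refine ⟨differentiableOn_const 0, 0, ?_⟩
  rintro _ ⟨R, -, rfl⟩
  simp [Real.zero_rpow hr.ne', Real.circleAverage_const]

theorem MemHardyDisc.add {r : ℝ} (hr : 0 < r) (hr1 : r < 1) {f g : ℂ → ℂ}
    (hf : MemHardyDisc r f) (hg : MemHardyDisc r g) : MemHardyDisc r (f + g) := by
  obtain ⟨A, hA⟩ := hf.2
  obtain ⟨B, hB⟩ := hg.2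
  refine ⟨hf.1.add hg.1, A + B, ?_⟩
  rintro _ ⟨R, hR, rfl⟩
  have iF := circleIntegrable_norm_rpow hr hf.1 hR
  have iG := circleIntegrable_norm_rpow hr hg.1 hR
  have hle := Real.circleAverage_mono (circleIntegrable_norm_rpow hr (hf.1.add hg.1) hR)
    (iF.add iG) (fun z _ => norm_add_rpow_le hr hr1 (f z) (g z))
  have hsum := Real.circleAverage_add iF iG
  have h1 := hA ⟨R, hR, rfl⟩
  have h2 := hB ⟨R, hR, rfl⟩
  exact (hle.trans_eq hsum).trans (add_le_add h1 h2)

theorem MemHardyDisc.smul {r : ℝ} (c : ℂ) {f : ℂ → ℂ}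
    (hf : MemHardyDisc r f) : MemHardyDisc r (c • f) := by
  obtain ⟨A, hA⟩ := hf.2
  refine ⟨hf.1.const_smul c, ‖c‖ ^ r * A, ?_⟩
  rintro _ ⟨R, hR, rfl⟩
  have h : (fun z => ‖(c • f) z‖ ^ r) = fun z => (‖c‖ ^ r) • (‖f z‖ ^ r) := by
    funext z
    simp [Real.mul_rpow (norm_nonneg c) (norm_nonneg (f z))]
  simp only [h]
  rw [Real.circleAverage_fun_smul]
  exact mul_le_mul_of_nonneg_left (hA ⟨R, hR, rfl⟩) (Real.rpow_nonneg (norm_nonneg c) r)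

/-- `g` is the radial boundary function of `f`: for almost every `t`,
`f(R e^{it}) → g(t)` as `R → 1⁻`. -/
def IsRadialLimit (f : ℂ → ℂ) (g : Torus → ℂ) : Prop :=
  ∀ᵐ t ∂mes, Tendsto (fun R : ℝ => f ((R : ℂ) * (AddCircle.toCircle t : ℂ))) (𝓝[<] 1) (𝓝 (g t))

/-- `H^r(𝕋)`, the space of all radial boundary functions of members of `H^r(𝔻)`, as a linear
subspace of `L^r(𝕋)`. -/
def hardyCircle {r : ℝ} (hr : 0 < r) (hr1 : r < 1) : Submodule ℂ (Lr r) where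
  carrier := {g | ∃ f : ℂ → ℂ, MemHardyDisc r f ∧ IsRadialLimit f g}
  zero_mem' := by
    refine ⟨0, MemHardyDisc.zero hr, ?_⟩
    filter_upwards [Lp.coeFn_zero ℂ (ENNReal.ofReal r) mes] with t ht
    rw [ht]
    exact tendsto_const_nhds
  add_mem' := by
    rintro g₁ g₂ ⟨f₁, h₁, l₁⟩ ⟨f₂, h₂, l₂⟩
    refine ⟨f₁ + f₂, h₁.add hr hr1 h₂, ?_⟩
    filter_upwards [l₁, l₂, Lp.coeFn_add g₁ g₂] with t t₁ t₂ ht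
    rw [ht]
    exact t₁.add t₂
  smul_mem' := by
    rintro c g ⟨f, h, l⟩
    refine ⟨c • f, h.smul c, ?_⟩
    filter_upwards [l, Lp.coeFn_smul c g] with t tl ht
    rw [ht]
    exact tl.const_smul c

/-- The operator `(T f)(t) = f(t + α)` on `L^r(𝕋)` induced by the rotation `t ↦ t + α`, i.e.
`e^{it} ↦ e^{iα} e^{it}`. -/
def rotOp (r α : ℝ) : Lr r →ₗ[ℂ] Lr r :=
  Lp.compMeasurePreservingₗ ℂ (fun t : Torus => t + (α : Torus))
    (measurePreserving_add_right mes (α : Torus))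

/-- The subspace of constant functions. -/
def constants (r : ℝ) : Submodule ℂ (Lr r) :=
  LinearMap.range (Lp.constₗ (ENNReal.ofReal r) mes ℂ : ℂ →ₗ[ℂ] Lr r)

/-- The image `(I - T) W` of a subspace `W`, where `T` is the rotation operator. -/
def coboundaries (r α : ℝ) (W : Submodule ℂ (Lr r)) : Submodule ℂ (Lr r) :=
  W.map (LinearMap.id - rotOp r α)

end HardyRotation

end

open MeasureTheory Filter Topology

namespace HardyRotation

/-! Everything about `H^r` rests on one inequality, `norm_rpow_le_of_isRadialLimit`: if `F ∈ H^r(𝔻)`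
has boundary function `g`, then `|F(w)|^r` is at most the Poisson integral of `|g|^r` at `w`. At `w
= 0` it makes `g ↦ F(0)` a continuous functional for the metric of `L^r`. Since `F` and its rotates
agree at `0`, this functional kills `(I - T)H^r`, hence its closure, while it takes the value `c` at
the constant `c`. So the sum is direct.

Conversely `z^n` with `n ≥ 1` is an eigenvector of `T` with eigenvalue `e^{inα} ≠ 1`, so every
polynomial vanishing at `0` is a coboundary. The inequality, integrated over circles, shows that the
dilates `F(R·)` tend to `g` in `L^r`; they are uniform limits of polynomials, so `g - F(0)` lies in
the closure of `(I - T)H^r`.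

That this closure stays inside `H^r` requires `H^r(𝕋)` to be closed. The inequality makes extensions
of an approximating sequence converge locally uniformly to some `G`, and the growth of Poisson
integrals at Lebesgue points shows that `G` has the right radial limits.

On the whole of `L^r`, let `n` be the hitting time of a small arc `U`. Then `1 - (n - Tn)` is the
return time on `U` and zero elsewhere. By Kac's formula its integral is one; being concentrated on a
small set, it has a small `r`-th moment because `r < 1`. -/

/-! ### The circle and the Poisson kernel. -/

/-- The point `e^{it}` of the complex plane. -/
noncomputable abbrev unitPt (t : Torus) : ℂ := (AddCircle.toCircle t : ℂ)

theorem norm_unitPt (t : Torus) : ‖unitPt t‖ = 1 := Circle.norm_coe _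

theorem continuous_unitPt : Continuous unitPt :=
  continuous_subtype_val.comp AddCircle.continuous_toCircle

theorem unitPt_add (s t : Torus) : unitPt (s + t) = unitPt s * unitPt t := by
  simp [unitPt, AddCircle.toCircle_add]

theorem unitPt_coe (x : ℝ) : unitPt (x : Torus) = Complex.exp (x * Complex.I) := by
  have h : (2 * Real.pi / (2 * Real.pi)) = 1 := div_self Real.two_pi_pos.ne'
  rw [unitPt, AddCircle.toCircle_apply_mk, h, one_mul, Circle.coe_exp]

theorem norm_ofReal_mul_unitPt {R : ℝ} (hR : 0 ≤ R) (t : Torus) : ‖(R : ℂ) * unitPt t‖ = R := by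
  rw [norm_mul, norm_unitPt, mul_one, Complex.norm_real, Real.norm_of_nonneg hR]

theorem exists_unitPt_eq {z : ℂ} (hz : ‖z‖ = 1) : ∃ t, unitPt t = z := by
  refine ⟨(Complex.arg z : Torus), ?_⟩
  have h := Complex.norm_mul_exp_arg_mul_I z
  rwa [hz, Complex.ofReal_one, one_mul, ← unitPt_coe] at h

theorem circleAverage_eq_integral {E : Type*} [NormedAddCommGroup E] [NormedSpace ℝ E]
    (f : ℂ → E) (R : ℝ) :
    Real.circleAverage f 0 R = ∫ t, f ((R : ℂ) * unitPt t) ∂mes := by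
  rw [AddCircle.integral_haarAddCircle,
    ← AddCircle.intervalIntegral_preimage (2 * Real.pi) 0, Real.circleAverage, zero_add]
  congr 1
  refine intervalIntegral.integral_congr fun x _ => ?_
  simp [circleMap, unitPt_coe]

/-- The Poisson kernel of the disc at the interior point `w` and the boundary point `e^{it}`. -/
noncomputable def poisson (w : ℂ) (t : Torus) : ℝ := (1 - ‖w‖ ^ 2) / ‖unitPt t - w‖ ^ 2

theorem poisson_eq_poissonKernel (w : ℂ) (t : Torus) :
    poisson w t = poissonKernel 0 w (unitPt t) := by
  rw [poisson, poissonKernel, sub_zero, sub_zero, norm_unitPt, one_pow]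

theorem unitPt_sub_ne_zero {w : ℂ} (hw : ‖w‖ < 1) (t : Torus) : unitPt t - w ≠ 0 := by
  intro h
  have := norm_unitPt t
  rw [sub_eq_zero.mp h] at this
  exact hw.ne this

theorem poisson_pos {w : ℂ} (hw : ‖w‖ < 1) (t : Torus) : 0 < poisson w t := by
  have h1 := norm_pos_iff.mpr (unitPt_sub_ne_zero hw t)
  have h2 := norm_nonneg w
  have : 0 < 1 - ‖w‖ ^ 2 := by nlinarith
  unfold poisson
  positivity

theorem poisson_le {w : ℂ} (hw : ‖w‖ < 1) (t : Torus) : poisson w t ≤ 2 / (1 - ‖w‖) := by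
  have h1 : 1 - ‖w‖ ≤ ‖unitPt t - w‖ := by
    have := norm_sub_norm_le (unitPt t) w
    rwa [norm_unitPt] at this
  have h2 := norm_nonneg w
  have h3 : 0 < 1 - ‖w‖ := by linarith
  unfold poisson
  rw [div_le_div_iff₀ (by nlinarith) h3]
  have h4 : (1 - ‖w‖) ^ 2 ≤ ‖unitPt t - w‖ ^ 2 := by gcongr
  nlinarith

theorem continuous_poisson {w : ℂ} (hw : ‖w‖ < 1) : Continuous (poisson w) := by
  refine Continuous.div continuous_const ?_ fun t => ?_
  · exact ((continuous_unitPt.sub continuous_const).norm).pow 2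
  · have := norm_pos_iff.mpr (unitPt_sub_ne_zero hw t)
    positivity

theorem integrable_poisson_mul {w : ℂ} (hw : ‖w‖ < 1) {h : Torus → ℝ} (hh : Integrable h mes) :
    Integrable (fun t => poisson w t * h t) mes := by
  refine hh.bdd_mul (c := 2 / (1 - ‖w‖)) (continuous_poisson hw).aestronglyMeasurable ?_
  refine Eventually.of_forall fun t => ?_
  rw [Real.norm_of_nonneg (poisson_pos hw t).le]
  exact poisson_le hw t

theorem integral_poisson_smul {E : Type*} [NormedAddCommGroup E] [NormedSpace ℂ E]
    [CompleteSpace E] {f : ℂ → E} (hf : DiffContOnCl ℂ f (Metric.ball 0 1)) {w : ℂ}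
    (hw : ‖w‖ < 1) : ∫ t, poisson w t • f (unitPt t) ∂mes = f w := by
  have h := hf.circleAverage_poissonKernel_smul (mem_ball_zero_iff.mpr hw)
  rw [circleAverage_eq_integral] at h
  rw [← h]
  simp [poisson_eq_poissonKernel]

theorem integral_poisson {w : ℂ} (hw : ‖w‖ < 1) : ∫ t, poisson w t ∂mes = 1 := by
  have h := integral_poisson_smul (f := fun _ => (1 : ℂ)) diffContOnCl_const hw
  simp only [Complex.real_smul, mul_one] at h
  rw [integral_complex_ofReal] at h
  exact_mod_cast h

theorem integrable_of_continuous {E : Type*} [NormedAddCommGroup E] {f : Torus → E}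
    (hf : Continuous f) : Integrable f mes :=
  hf.integrable_of_hasCompactSupport (HasCompactSupport.of_compactSpace f)

theorem integral_poisson_mul_re {q : ℂ → ℂ} (hq : Differentiable ℂ q) {w : ℂ} (hw : ‖w‖ < 1) :
    ∫ t, poisson w t * (q (unitPt t)).re ∂mes = (q w).re := by
  rw [← integral_poisson_smul hq.diffContOnCl hw]
  have hi : Integrable (fun t => poisson w t • q (unitPt t)) mes :=
    integrable_of_continuous ((continuous_poisson hw).smul (hq.continuous.comp continuous_unitPt))
  have := Complex.reCLM.integral_comp_comm hi
  simpa using this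

theorem integral_poisson_mul_mono {w : ℂ} (hw : ‖w‖ < 1) {h k : Torus → ℝ}
    (hh : Integrable h mes) (hk : Integrable k mes) (hle : ∀ᵐ t ∂mes, h t ≤ k t) :
    ∫ t, poisson w t * h t ∂mes ≤ ∫ t, poisson w t * k t ∂mes := by
  refine integral_mono_ae (integrable_poisson_mul hw hh) (integrable_poisson_mul hw hk) ?_
  filter_upwards [hle] with t ht
  exact mul_le_mul_of_nonneg_left ht (poisson_pos hw t).le

theorem integral_poisson_mul_affine {w : ℂ} (hw : ‖w‖ < 1) {h : Torus → ℝ}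
    (hh : Integrable h mes) (a b : ℝ) :
    ∫ t, poisson w t * (a * h t + b) ∂mes = a * ∫ t, poisson w t * h t ∂mes + b := by
  have h1 : (fun t => poisson w t * (a * h t + b)) =
      fun t => a * (poisson w t * h t) + b * poisson w t := by
    funext t; ring
  rw [h1, integral_add ((integrable_poisson_mul hw hh).const_mul a)
    ((integrable_of_continuous (continuous_poisson hw)).const_mul b), integral_const_mul,
    integral_const_mul, integral_poisson hw, mul_one]

/-- Jensen's inequality for the exponential and the Poisson kernel. -/
theorem exp_integral_poisson_le {w : ℂ} (hw : ‖w‖ < 1) {h : Torus → ℝ}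
    (hh : Integrable h mes) (he : Integrable (fun t => Real.exp (h t)) mes) :
    Real.exp (∫ t, poisson w t * h t ∂mes) ≤ ∫ t, poisson w t * Real.exp (h t) ∂mes := by
  set m := ∫ t, poisson w t * h t ∂mes with hm
  -- The graph of `exp` lies above its tangent line at the mean `m`; integrating against a kernel of
  -- mass one gives Jensen's inequality.
  have h1 := integral_poisson_mul_mono hw
    (h := fun t => Real.exp m * h t + Real.exp m * (1 - m))
    ((hh.const_mul _).add (integrable_const _)) he
    (Eventually.of_forall fun t => by
      have h2 := Real.add_one_le_exp (h t - m)
      have h3 : Real.exp (h t) = Real.exp m * Real.exp (h t - m) := by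
        rw [← Real.exp_add]; ring_nf
      rw [h3]
      nlinarith [Real.exp_pos m])
  rw [integral_poisson_mul_affine hw hh, ← hm] at h1
  linarith

/-- The Cauchy-Schwarz inequality for the Poisson kernel. -/
theorem sq_integral_poisson_le {w : ℂ} (hw : ‖w‖ < 1) {h : Torus → ℝ}
    (hh : Integrable h mes) (he : Integrable (fun t => h t ^ 2) mes) :
    (∫ t, poisson w t * h t ∂mes) ^ 2 ≤ ∫ t, poisson w t * h t ^ 2 ∂mes := by
  set m := ∫ t, poisson w t * h t ∂mes with hm
  -- The same device for the square: `2 m x - m ^ 2` is its tangent line at the mean.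
  have hi : Integrable (fun t => (2 * m) * h t + (-m ^ 2)) mes :=
    (hh.const_mul (2 * m)).add (integrable_const (-m ^ 2))
  have h1 := integral_poisson_mul_mono hw hi he
    (Eventually.of_forall fun t => by
      show 2 * m * h t + -m ^ 2 ≤ h t ^ 2
      nlinarith [sq_nonneg (h t - m)])
  rw [integral_poisson_mul_affine hw hh, ← hm] at h1
  linarith

/-! ### Subharmonicity of powers of the modulus. -/

/-- Negative frequencies are conjugates of powers of `e^{it}`. Hence the real part of a
trigonometric polynomial is that of the entire function `q₁ + q₂`. -/
theorem exists_add_conj_of_mem_span_fourier {f : C(Torus, ℂ)}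
    (hf : f ∈ Submodule.span ℂ (Set.range (@fourier (2 * Real.pi)))) :
    ∃ q₁ q₂ : ℂ → ℂ, Differentiable ℂ q₁ ∧ Differentiable ℂ q₂ ∧
      ∀ t, f t = q₁ (unitPt t) + (starRingEnd ℂ) (q₂ (unitPt t)) := by
  induction hf using Submodule.span_induction with
  | mem x hx =>
    obtain ⟨n, rfl⟩ := hx
    obtain ⟨k, rfl | rfl⟩ := n.eq_nat_or_neg
    · refine ⟨fun z => z ^ k, fun _ => 0, by fun_prop, by fun_prop, fun t => ?_⟩
      simp [unitPt, AddCircle.toCircle_nsmul]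
    · refine ⟨fun _ => 0, fun z => z ^ k, by fun_prop, by fun_prop, fun t => ?_⟩
      rw [fourier_neg]
      simp [unitPt, AddCircle.toCircle_nsmul]
  | zero => exact ⟨fun _ => 0, fun _ => 0, by fun_prop, by fun_prop, fun t => by simp⟩
  | add x y _ _ hx hy =>
    obtain ⟨a, b, ha, hb, hab⟩ := hx
    obtain ⟨c, d, hc, hd, hcd⟩ := hy
    refine ⟨fun z => a z + c z, fun z => b z + d z, by fun_prop, by fun_prop, fun t => ?_⟩
    simp [hab, hcd]; ring
  | smul c x _ hx =>
    obtain ⟨a, b, ha, hb, hab⟩ := hx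
    refine ⟨fun z => c * a z, fun z => (starRingEnd ℂ) c * b z, by fun_prop, by fun_prop,
      fun t => ?_⟩
    simp [hab]; ring

/-- Continuous real functions on the circle are uniform limits of real parts of entire functions. -/
theorem exists_entire_re_near {u : Torus → ℝ} (hu : Continuous u) {δ : ℝ} (hδ : 0 < δ) :
    ∃ q : ℂ → ℂ, Differentiable ℂ q ∧ ∀ t, |u t - (q (unitPt t)).re| < δ := by
  let U : C(Torus, ℂ) := ⟨fun t => (u t : ℂ), Complex.continuous_ofReal.comp hu⟩
  have hU : U ∈ (Submodule.span ℂ (Set.range (@fourier (2 * Real.pi)))).topologicalClosure := by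
    rw [span_fourier_closure_eq_top]; trivial
  obtain ⟨f, hf, hd⟩ := Metric.mem_closure_iff.mp hU δ hδ
  obtain ⟨q₁, q₂, h₁, h₂, h⟩ := exists_add_conj_of_mem_span_fourier hf
  refine ⟨fun z => q₁ z + q₂ z, by fun_prop, fun t => ?_⟩
  have h3 : ‖U t - f t‖ < δ := by
    rw [← dist_eq_norm]; exact (ContinuousMap.dist_apply_le_dist t).trans_lt hd
  have h4 : u t - (q₁ (unitPt t) + q₂ (unitPt t)).re = (U t - f t).re := by
    rw [h t]; simp [U]
  rw [h4]
  exact (Complex.abs_re_le_norm _).trans_lt h3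

/-- If `Re q` is within `δ` of `u` on the circle, then `e^{-q} F` is bounded there by `e^δ`, and the
maximum principle carries the bound inside. The second `δ` in `2 * δ` is the price of replacing `Re
q(w)` by the Poisson integral of `u`. -/
theorem norm_le_exp_integral_poisson {F : ℂ → ℂ} (hF : DiffContOnCl ℂ F (Metric.ball 0 1))
    {u : Torus → ℝ} (hu : Continuous u) (hle : ∀ t, ‖F (unitPt t)‖ ≤ Real.exp (u t)) {w : ℂ}
    (hw : ‖w‖ < 1) : ‖F w‖ ≤ Real.exp (∫ t, poisson w t * u t ∂mes) := by
  have key : ∀ δ > 0, ‖F w‖ ≤ Real.exp ((∫ t, poisson w t * u t ∂mes) + 2 * δ) := by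
    intro δ hδ
    obtain ⟨q, hq, hqu⟩ := exists_entire_re_near hu hδ
    have hG : DiffContOnCl ℂ (fun z => Complex.exp (-q z) • F z) (Metric.ball 0 1) :=
      (hq.neg.cexp.diffContOnCl).smul hF
    have hb := Complex.norm_le_of_forall_mem_frontier_norm_le Metric.isBounded_ball hG
      (C := Real.exp δ) (fun z hz => by
        rw [frontier_ball (0 : ℂ) one_ne_zero, mem_sphere_zero_iff_norm] at hz
        obtain ⟨t, rfl⟩ := exists_unitPt_eq hz
        rw [norm_smul, Complex.norm_exp, Complex.neg_re]
        calc _ ≤ Real.exp (-(q (unitPt t)).re) * Real.exp (u t) := by gcongr; exact hle t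
          _ = Real.exp (u t - (q (unitPt t)).re) := by rw [← Real.exp_add]; ring_nf
          _ ≤ _ := Real.exp_le_exp.mpr (le_of_abs_le (hqu t).le))
      (subset_closure (mem_ball_zero_iff.mpr hw))
    rw [norm_smul, Complex.norm_exp, Complex.neg_re] at hb
    have h1 : (q w).re ≤ (∫ t, poisson w t * u t ∂mes) + δ := by
      rw [← integral_poisson_mul_re hq hw]
      have := integral_poisson_mul_mono hw (h := fun t => (q (unitPt t)).re)
        (k := fun t => 1 * u t + δ)
        (integrable_of_continuous (Complex.continuous_re.comp
          (hq.continuous.comp continuous_unitPt)))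
        (integrable_of_continuous (by fun_prop))
        (Eventually.of_forall fun t => by
          have := (abs_lt.mp (hqu t)).1
          linarith)
      rwa [integral_poisson_mul_affine hw (integrable_of_continuous hu), one_mul] at this
    calc ‖F w‖ = Real.exp ((q w).re) * (Real.exp (-(q w).re) * ‖F w‖) := by
          rw [← mul_assoc, ← Real.exp_add, add_neg_cancel, Real.exp_zero, one_mul]
      _ ≤ Real.exp ((q w).re) * Real.exp δ := by gcongr
      _ = Real.exp ((q w).re + δ) := by rw [Real.exp_add]
      _ ≤ _ := Real.exp_le_exp.mpr (by linarith)
  have hlim : Tendsto (fun δ : ℝ => Real.exp ((∫ t, poisson w t * u t ∂mes) + 2 * δ)) (𝓝[>] 0)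
      (𝓝 (Real.exp ((∫ t, poisson w t * u t ∂mes) + 2 * 0))) :=
    (Continuous.tendsto (by fun_prop) 0).mono_left nhdsWithin_le_nhds
  rw [mul_zero, add_zero] at hlim
  exact ge_of_tendsto hlim (eventually_mem_nhdsWithin.mono fun δ hδ => key δ hδ)

/-- The subharmonicity of `‖F‖ ^ p`. -/
theorem norm_rpow_le_integral_poisson {F : ℂ → ℂ} (hF : DiffContOnCl ℂ F (Metric.ball 0 1))
    {p : ℝ} (hp : 0 < p) (hp1 : p ≤ 1) {w : ℂ} (hw : ‖w‖ < 1) :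
    ‖F w‖ ^ p ≤ ∫ t, poisson w t * ‖F (unitPt t)‖ ^ p ∂mes := by
  have hFc : Continuous fun t => F (unitPt t) :=
    hF.continuousOn_ball.comp_continuous continuous_unitPt fun t => by
      simp [norm_unitPt]
  have hpc : Continuous fun t => ‖F (unitPt t)‖ ^ p := hFc.norm.rpow_const fun _ => Or.inr hp.le
  -- Adding `ε` keeps the logarithm continuous at boundary zeros of `F`. After Jensen, subadditivity
  -- of `x ↦ x ^ p` for `p ≤ 1` separates off the error `ε ^ p`.
  have key : ∀ ε > 0, ‖F w‖ ^ p ≤ (∫ t, poisson w t * ‖F (unitPt t)‖ ^ p ∂mes) + ε ^ p := by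
    intro ε hε
    have hpos : ∀ t, 0 < ‖F (unitPt t)‖ + ε := fun t => by positivity
    have hu : Continuous fun t => Real.log (‖F (unitPt t)‖ + ε) :=
      (hFc.norm.add continuous_const).log fun t => (hpos t).ne'
    have h1 := norm_le_exp_integral_poisson hF hu
      (fun t => by rw [Real.exp_log (hpos t)]; linarith) hw
    calc ‖F w‖ ^ p ≤ (Real.exp (∫ t, poisson w t * Real.log (‖F (unitPt t)‖ + ε) ∂mes)) ^ p := by
          gcongr
      _ = Real.exp (∫ t, poisson w t * (p * Real.log (‖F (unitPt t)‖ + ε) + 0) ∂mes) := by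
          rw [← Real.exp_mul, integral_poisson_mul_affine hw (integrable_of_continuous hu), add_zero,
            mul_comm]
      _ ≤ ∫ t, poisson w t * Real.exp (p * Real.log (‖F (unitPt t)‖ + ε) + 0) ∂mes :=
          exp_integral_poisson_le hw (integrable_of_continuous (by fun_prop))
            (integrable_of_continuous (by fun_prop))
      _ ≤ ∫ t, poisson w t * (1 * ‖F (unitPt t)‖ ^ p + ε ^ p) ∂mes := by
          refine integral_poisson_mul_mono hw (integrable_of_continuous (by fun_prop))
            (integrable_of_continuous (by fun_prop)) (Eventually.of_forall fun t => ?_)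
          simp only [add_zero, one_mul]
          rw [mul_comm, ← Real.rpow_def_of_pos (hpos t)]
          exact Real.rpow_add_le_add_rpow (norm_nonneg _) hε.le hp.le hp1
      _ = _ := by
          rw [integral_poisson_mul_affine hw (integrable_of_continuous hpc), one_mul]
  have hlim : Tendsto (fun ε : ℝ => (∫ t, poisson w t * ‖F (unitPt t)‖ ^ p ∂mes) + ε ^ p) (𝓝[>] 0)
      (𝓝 ((∫ t, poisson w t * ‖F (unitPt t)‖ ^ p ∂mes) + 0 ^ p)) :=
    (Continuous.tendsto (continuous_const.add
      (Real.continuous_rpow_const hp.le)) 0).mono_left nhdsWithin_le_nhds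
  rw [Real.zero_rpow hp.ne', add_zero] at hlim
  exact ge_of_tendsto hlim (eventually_mem_nhdsWithin.mono fun ε hε => key ε hε)

/-! ### Domination of a Hardy function by its boundary function. -/

theorem mem_Ico_of_nhdsLT : ∀ᶠ R : ℝ in 𝓝[<] 1, R ∈ Set.Ico (0 : ℝ) 1 := by
  filter_upwards [Ioo_mem_nhdsLT (zero_lt_one (α := ℝ))] with R hR using ⟨hR.1.le, hR.2⟩

theorem norm_ofReal_mul_lt_one {R : ℝ} (hR : R ∈ Set.Ico (0 : ℝ) 1) {z : ℂ} (hz : ‖z‖ ≤ 1) :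
    ‖(R : ℂ) * z‖ < 1 := by
  rw [norm_mul, Complex.norm_real, Real.norm_of_nonneg hR.1]
  nlinarith [hR.1, hR.2, norm_nonneg z]

theorem diffContOnCl_dilate {F : ℂ → ℂ} (hF : DifferentiableOn ℂ F (Metric.ball 0 1)) {R : ℝ}
    (hR : R ∈ Set.Ico (0 : ℝ) 1) : DiffContOnCl ℂ (fun z => F (R * z)) (Metric.ball 0 1) := by
  refine DifferentiableOn.diffContOnCl ?_
  rw [closure_ball (0 : ℂ) one_ne_zero]
  refine hF.comp (by fun_prop) fun z hz => ?_
  exact mem_ball_zero_iff.mpr (norm_ofReal_mul_lt_one hR (mem_closedBall_zero_iff.mp hz))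

theorem continuous_dilate {F : ℂ → ℂ} (hF : DifferentiableOn ℂ F (Metric.ball 0 1)) {R : ℝ}
    (hR : R ∈ Set.Ico (0 : ℝ) 1) : Continuous fun t => F (R * unitPt t) :=
  hF.continuousOn.comp_continuous (continuous_const.mul continuous_unitPt) fun t =>
    mem_ball_zero_iff.mpr (norm_ofReal_mul_lt_one hR (norm_unitPt t).le)

theorem MemHardyDisc.exists_integral_le {r : ℝ} {F : ℂ → ℂ} (hF : MemHardyDisc r F) :
    ∃ A, ∀ R ∈ Set.Ico (0 : ℝ) 1, ∫ t, ‖F (R * unitPt t)‖ ^ r ∂mes ≤ A := by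
  obtain ⟨A, hA⟩ := hF.2
  refine ⟨A, fun R hR => ?_⟩
  rw [← circleAverage_eq_integral (fun z => ‖F z‖ ^ r) R]
  exact hA ⟨R, hR, rfl⟩

theorem tendsto_dilate_apply {F : ℂ → ℂ} (hF : DifferentiableOn ℂ F (Metric.ball 0 1)) {w : ℂ}
    (hw : ‖w‖ < 1) : Tendsto (fun R : ℝ => F (R * w)) (𝓝[<] 1) (𝓝 (F w)) := by
  have hc : ContinuousAt F w :=
    (hF.continuousOn).continuousAt (Metric.isOpen_ball.mem_nhds (mem_ball_zero_iff.mpr hw))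
  have h1 : Tendsto (fun R : ℝ => (R : ℂ) * w) (𝓝[<] 1) (𝓝 w) := by
    have : Tendsto (fun R : ℝ => (R : ℂ) * w) (𝓝 1) (𝓝 (((1 : ℝ) : ℂ) * w)) :=
      Continuous.tendsto (by fun_prop) 1
    rw [Complex.ofReal_one, one_mul] at this
    exact this.mono_left nhdsWithin_le_nhds
  exact hc.tendsto.comp h1

/-- A Hardy function is controlled by the Poisson integral of its boundary function: the exponent
is halved first, so that the means of `‖F‖ ^ (r / 2)` are uniformly integrable. -/
theorem norm_rpow_half_le_of_isRadialLimit {r : ℝ} (hr : 0 < r) (hr1 : r < 1) {F : ℂ → ℂ}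
    (hF : MemHardyDisc r F) {g : Torus → ℂ}
    (hg : Integrable (fun t => ‖g t‖ ^ (r / 2)) mes) (hl : IsRadialLimit F g) {w : ℂ}
    (hw : ‖w‖ < 1) : ‖F w‖ ^ (r / 2) ≤ ∫ t, poisson w t * ‖g t‖ ^ (r / 2) ∂mes := by
  obtain ⟨A, hA⟩ := hF.exists_integral_le
  set p := r / 2 with hp
  have hp0 : 0 < p := by positivity
  have hsq : ∀ x : ℝ, 0 ≤ x → (x ^ p) ^ 2 = x ^ r := fun x hx => by
    rw [← Real.rpow_natCast, ← Real.rpow_mul hx, hp]; norm_num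
  have hmin : ∀ K : ℝ, Integrable (fun t => min (‖g t‖ ^ p) K) mes := fun K =>
    hg.inf (integrable_const K)
  -- Truncation: `x ≤ min x K + x ^ 2 / K` with `x = ‖F‖ ^ p`. The truncated part passes to the
  -- limit `R → 1` by dominated convergence; since `x ^ 2 = ‖F‖ ^ r`, the rest is bounded through
  -- the Hardy means, uniformly in `R`, and vanishes as `K → ∞`.
  have key : ∀ K > 0, ‖F w‖ ^ p ≤ (∫ t, poisson w t * ‖g t‖ ^ p ∂mes) +
      (2 / (1 - ‖w‖) * A) * K⁻¹ := by
    intro K hK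
    have hlim : Tendsto (fun R : ℝ => ∫ t, poisson w t * min (‖F (R * unitPt t)‖ ^ p) K ∂mes)
        (𝓝[<] 1) (𝓝 (∫ t, poisson w t * min (‖g t‖ ^ p) K ∂mes)) := by
      refine tendsto_integral_filter_of_dominated_convergence (fun t => poisson w t * K) ?_ ?_
        ((integrable_of_continuous (continuous_poisson hw)).mul_const K) ?_
      · filter_upwards [mem_Ico_of_nhdsLT] with R hR
        exact ((continuous_poisson hw).mul (((continuous_dilate hF.1 hR).norm.rpow_const
          fun _ => Or.inr hp0.le).min continuous_const)).aestronglyMeasurable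
      · refine Eventually.of_forall fun R => Eventually.of_forall fun t => ?_
        have h1 : 0 ≤ min (‖F (R * unitPt t)‖ ^ p) K := le_min (by positivity) hK.le
        rw [Real.norm_of_nonneg (mul_nonneg (poisson_pos hw t).le h1)]
        exact mul_le_mul_of_nonneg_left (min_le_right _ _) (poisson_pos hw t).le
      · filter_upwards [hl] with t ht
        exact ((ht.norm.rpow_const (Or.inr hp0.le)).min tendsto_const_nhds).const_mul _
    have hleft : Tendsto (fun R : ℝ => ‖F (R * w)‖ ^ p) (𝓝[<] 1) (𝓝 (‖F w‖ ^ p)) :=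
      (tendsto_dilate_apply hF.1 hw).norm.rpow_const (Or.inr hp0.le)
    refine (le_of_tendsto_of_tendsto hleft
      (hlim.add_const ((2 / (1 - ‖w‖) * A) * K⁻¹)) ?_).trans ?_
    · filter_upwards [mem_Ico_of_nhdsLT] with R hR
      have hFp : Continuous fun t => ‖F (R * unitPt t)‖ ^ p :=
        (continuous_dilate hF.1 hR).norm.rpow_const fun _ => Or.inr hp0.le
      have hFr : Continuous fun t => ‖F (R * unitPt t)‖ ^ r :=
        (continuous_dilate hF.1 hR).norm.rpow_const fun _ => Or.inr hr.le
      have h0 : 0 < 2 / (1 - ‖w‖) := div_pos two_pos (by linarith)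
      have h1 : ∫ t, poisson w t * ‖F (R * unitPt t)‖ ^ r ∂mes ≤ 2 / (1 - ‖w‖) * A := by
        calc _ ≤ ∫ t, 2 / (1 - ‖w‖) * ‖F (R * unitPt t)‖ ^ r ∂mes := by
              refine integral_mono (integrable_poisson_mul hw (integrable_of_continuous hFr))
                ((integrable_of_continuous hFr).const_mul _) fun t => ?_
              exact mul_le_mul_of_nonneg_right (poisson_le hw t) (by positivity)
          _ ≤ _ := by
              rw [integral_const_mul]
              exact mul_le_mul_of_nonneg_left (hA R hR) h0.le
      have hc1 : Continuous fun t => poisson w t * min (‖F (R * unitPt t)‖ ^ p) K :=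
        (continuous_poisson hw).mul (hFp.min continuous_const)
      have hc2 : Continuous fun t => poisson w t * ‖F (R * unitPt t)‖ ^ r * K⁻¹ :=
        ((continuous_poisson hw).mul hFr).mul continuous_const
      calc ‖F (R * w)‖ ^ p
          ≤ ∫ t, poisson w t * ‖F (R * unitPt t)‖ ^ p ∂mes :=
            norm_rpow_le_integral_poisson (diffContOnCl_dilate hF.1 hR) hp0 (by linarith) hw
        _ ≤ ∫ t, (poisson w t * min (‖F (R * unitPt t)‖ ^ p) K
              + poisson w t * ‖F (R * unitPt t)‖ ^ r * K⁻¹) ∂mes := by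
            refine integral_mono (integrable_poisson_mul hw (integrable_of_continuous hFp))
              (integrable_of_continuous (hc1.add hc2)) fun t => ?_
            simp only
            rw [← hsq _ (norm_nonneg _), mul_assoc, ← mul_add]
            refine mul_le_mul_of_nonneg_left ?_ (poisson_pos hw t).le
            set x := ‖F (R * unitPt t)‖ ^ p
            have hx : 0 ≤ x := by positivity
            rcases le_total x K with h | h
            · rw [min_eq_left h]
              have : 0 ≤ x ^ 2 * K⁻¹ := by positivity
              linarith
            · rw [min_eq_right h]
              have : x ≤ x ^ 2 * K⁻¹ := by
                rw [← div_eq_mul_inv, le_div_iff₀ hK]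
                nlinarith
              linarith
        _ = (∫ t, poisson w t * min (‖F (R * unitPt t)‖ ^ p) K ∂mes) +
              (∫ t, poisson w t * ‖F (R * unitPt t)‖ ^ r ∂mes) * K⁻¹ := by
            rw [integral_add (integrable_of_continuous hc1) (integrable_of_continuous hc2),
              integral_mul_const]
        _ ≤ _ := by gcongr
    · gcongr ?_ + _
      exact integral_poisson_mul_mono hw (hmin K) hg (Eventually.of_forall fun t => min_le_left _ _)
  have hlim : Tendsto (fun K : ℝ => (∫ t, poisson w t * ‖g t‖ ^ p ∂mes) +
      (2 / (1 - ‖w‖) * A) * K⁻¹) atTop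
      (𝓝 ((∫ t, poisson w t * ‖g t‖ ^ p ∂mes) + (2 / (1 - ‖w‖) * A) * 0)) :=
    (tendsto_inv_atTop_zero.const_mul _).const_add _
  rw [mul_zero, add_zero] at hlim
  exact ge_of_tendsto hlim ((eventually_gt_atTop 0).mono key)

/-- Squaring the bound for the exponent `r / 2` and applying Cauchy-Schwarz to the Poisson
probability measure restores the exponent `r`. -/
theorem norm_rpow_le_of_isRadialLimit {r : ℝ} (hr : 0 < r) (hr1 : r < 1) {F : ℂ → ℂ}
    (hF : MemHardyDisc r F) {g : Torus → ℂ} (hgm : AEStronglyMeasurable g mes)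
    (hg : Integrable (fun t => ‖g t‖ ^ r) mes) (hl : IsRadialLimit F g) {w : ℂ}
    (hw : ‖w‖ < 1) : ‖F w‖ ^ r ≤ ∫ t, poisson w t * ‖g t‖ ^ r ∂mes := by
  have hsq : ∀ x : ℝ, 0 ≤ x → (x ^ (r / 2)) ^ 2 = x ^ r := fun x hx => by
    rw [← Real.rpow_natCast, ← Real.rpow_mul hx]; norm_num
  have hg2 : Integrable (fun t => (‖g t‖ ^ (r / 2)) ^ 2) mes := by
    simpa only [hsq _ (norm_nonneg _)] using hg
  have hgp : Integrable (fun t => ‖g t‖ ^ (r / 2)) mes := by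
    refine ((integrable_const (1 : ℝ)).add hg2).mono'
      (hgm.norm.aemeasurable.pow_const _).aestronglyMeasurable (Eventually.of_forall fun t => ?_)
    have hx : 0 ≤ ‖g t‖ ^ (r / 2) := by positivity
    rw [Real.norm_of_nonneg hx]
    show _ ≤ 1 + (‖g t‖ ^ (r / 2)) ^ 2
    nlinarith
  calc ‖F w‖ ^ r = (‖F w‖ ^ (r / 2)) ^ 2 := (hsq _ (norm_nonneg _)).symm
    _ ≤ (∫ t, poisson w t * ‖g t‖ ^ (r / 2) ∂mes) ^ 2 := by
        gcongr
        exact norm_rpow_half_le_of_isRadialLimit hr hr1 hF hgp hl hw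
    _ ≤ ∫ t, poisson w t * (‖g t‖ ^ (r / 2)) ^ 2 ∂mes := sq_integral_poisson_le hw hgp hg2
    _ = _ := by simp only [hsq _ (norm_nonneg _)]

/-! ### Means over circles and convergence of dilates in `L^r`. -/

/-- The difference of `|a - Rb|²` and `|b - Ra|²` is `(1 - R²)(|a|² - |b|²)`. Through this symmetry
the kernel also has mass one in the interior angle, which is what Fubini's theorem needs below. -/
theorem poisson_symm {R : ℝ} (hR : 0 ≤ R) (s t : Torus) :
    poisson (R * unitPt s) t = poisson (R * unitPt t) s := by
  have h : ∀ a b : ℂ, ‖a‖ = 1 → ‖b‖ = 1 → ‖a - R * b‖ ^ 2 = ‖b - R * a‖ ^ 2 := by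
    intro a b ha hb
    rw [← Complex.normSq_eq_norm_sq] at *
    have ha' : a.re * a.re + a.im * a.im = 1 := by
      rw [← Complex.normSq_apply, Complex.normSq_eq_norm_sq, ha, one_pow]
    have hb' : b.re * b.re + b.im * b.im = 1 := by
      rw [← Complex.normSq_apply, Complex.normSq_eq_norm_sq, hb, one_pow]
    rw [← Complex.normSq_eq_norm_sq, Complex.normSq_apply, Complex.normSq_apply]
    simp only [Complex.sub_re, Complex.sub_im, Complex.mul_re, Complex.mul_im, Complex.ofReal_re,
      Complex.ofReal_im, zero_mul, sub_zero, add_zero]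
    linear_combination (1 - R ^ 2) * (ha' - hb')
  rw [poisson, poisson, norm_ofReal_mul_unitPt hR, norm_ofReal_mul_unitPt hR,
    h _ _ (norm_unitPt t) (norm_unitPt s)]

theorem continuous_poisson_uncurry {R : ℝ} (hR : R ∈ Set.Ico (0 : ℝ) 1) :
    Continuous fun x : Torus × Torus => poisson (R * unitPt x.1) x.2 := by
  have h1 : Continuous fun x : Torus × Torus => unitPt x.1 := continuous_unitPt.comp continuous_fst
  have h2 : Continuous fun x : Torus × Torus => unitPt x.2 := continuous_unitPt.comp continuous_snd
  unfold poisson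
  refine Continuous.div ?_ ?_ fun x => ?_
  · exact continuous_const.sub ((continuous_const.mul h1).norm.pow 2)
  · exact (h2.sub (continuous_const.mul h1)).norm.pow 2
  · have := norm_pos_iff.mpr (unitPt_sub_ne_zero
      (norm_ofReal_mul_lt_one hR (norm_unitPt x.1).le) x.2)
    positivity

/-- The means over concentric circles of a Poisson integral. -/
theorem integral_integral_poisson {h : Torus → ℝ} (hh : Integrable h mes) {R : ℝ}
    (hR : R ∈ Set.Ico (0 : ℝ) 1) :
    Integrable (fun s => ∫ t, poisson (R * unitPt s) t * h t ∂mes) mes ∧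
    ∫ s, ∫ t, poisson (R * unitPt s) t * h t ∂mes ∂mes = ∫ t, h t ∂mes := by
  have hi : Integrable (fun x : Torus × Torus => poisson (R * unitPt x.1) x.2 * h x.2)
      (mes.prod mes) := by
    refine (hh.comp_snd mes).bdd_mul (c := 2 / (1 - R))
      (continuous_poisson_uncurry hR).aestronglyMeasurable (Eventually.of_forall fun x => ?_)
    have hx := norm_ofReal_mul_lt_one hR (norm_unitPt x.1).le
    have := poisson_le hx x.2
    rwa [norm_ofReal_mul_unitPt hR.1, ← Real.norm_of_nonneg (poisson_pos hx x.2).le] at this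
  refine ⟨hi.integral_prod_left, ?_⟩
  rw [integral_integral_swap hi]
  refine integral_congr_ae (Eventually.of_forall fun t => ?_)
  simp only
  rw [integral_mul_const]
  simp only [poisson_symm hR.1 _ t]
  rw [integral_poisson (norm_ofReal_mul_lt_one hR (norm_unitPt t).le), one_mul]

theorem integral_norm_rpow_dilate_le {r : ℝ} (hr : 0 < r) {F : ℂ → ℂ}
    (hF : DifferentiableOn ℂ F (Metric.ball 0 1)) {h : Torus → ℝ} (hh : Integrable h mes)
    (hle : ∀ w : ℂ, ‖w‖ < 1 → ‖F w‖ ^ r ≤ ∫ t, poisson w t * h t ∂mes) {R : ℝ}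
    (hR : R ∈ Set.Ico (0 : ℝ) 1) : ∫ t, ‖F (R * unitPt t)‖ ^ r ∂mes ≤ ∫ t, h t ∂mes := by
  obtain ⟨h1, h2⟩ := integral_integral_poisson hh hR
  rw [← h2]
  refine integral_mono (integrable_of_continuous ((continuous_dilate hF hR).norm.rpow_const
    fun _ => Or.inr hr.le)) h1 fun t => ?_
  exact hle _ (norm_ofReal_mul_lt_one hR (norm_unitPt t).le)

theorem memHardyDisc_of_le_poisson {r : ℝ} (hr : 0 < r) {F : ℂ → ℂ}
    (hF : DifferentiableOn ℂ F (Metric.ball 0 1)) {h : Torus → ℝ} (hh : Integrable h mes)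
    (hle : ∀ w : ℂ, ‖w‖ < 1 → ‖F w‖ ^ r ≤ ∫ t, poisson w t * h t ∂mes) : MemHardyDisc r F := by
  refine ⟨hF, ∫ t, h t ∂mes, ?_⟩
  rintro _ ⟨R, hR, rfl⟩
  simp only
  rw [circleAverage_eq_integral]
  exact integral_norm_rpow_dilate_le hr hF hh hle hR

theorem norm_sub_rpow_le {r : ℝ} (hr : 0 < r) (hr1 : r < 1) (a b : ℂ) :
    ‖a - b‖ ^ r ≤ ‖a‖ ^ r + ‖b‖ ^ r := by
  simpa [sub_eq_add_neg] using norm_add_rpow_le hr hr1 a (-b)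

/-- The dilates of a Hardy function converge in `L^r` to the boundary function. -/
theorem tendsto_integral_dilate_sub {r : ℝ} (hr : 0 < r) (hr1 : r < 1) {F : ℂ → ℂ}
    (hF : MemHardyDisc r F) {g : Torus → ℂ} (hgm : AEStronglyMeasurable g mes)
    (hg : Integrable (fun t => ‖g t‖ ^ r) mes) (hl : IsRadialLimit F g) :
    Tendsto (fun R : ℝ => ∫ t, ‖F (R * unitPt t) - g t‖ ^ r ∂mes) (𝓝[<] 1) (𝓝 0) := by
  -- By subadditivity `φ` lies between `0` and `2‖g‖ ^ r`, and it tends to the latter. Dominated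
  -- convergence thus applies without a maximal function.
  set φ : ℝ → Torus → ℝ := fun R t =>
    ‖F (R * unitPt t)‖ ^ r + ‖g t‖ ^ r - ‖F (R * unitPt t) - g t‖ ^ r with hφ
  have hlim : Tendsto (fun R : ℝ => ∫ t, φ R t ∂mes) (𝓝[<] 1)
      (𝓝 (∫ t, 2 * ‖g t‖ ^ r ∂mes)) := by
    refine tendsto_integral_filter_of_dominated_convergence (fun t => 2 * ‖g t‖ ^ r) ?_ ?_
      (hg.const_mul 2) ?_
    · filter_upwards [mem_Ico_of_nhdsLT] with R hR
      have h1 := (continuous_dilate hF.1 hR).aestronglyMeasurable (μ := mes)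
      exact (((h1.norm.aemeasurable.pow_const r).add hg.aemeasurable).sub
        ((h1.sub hgm).norm.aemeasurable.pow_const r)).aestronglyMeasurable
    · refine Eventually.of_forall fun R => Eventually.of_forall fun t => ?_
      have h1 := norm_sub_rpow_le hr hr1 (F (R * unitPt t)) (g t)
      have h2 := norm_add_rpow_le hr hr1 (F (R * unitPt t) - g t) (g t)
      rw [sub_add_cancel] at h2
      rw [Real.norm_of_nonneg (by simp only [hφ]; linarith)]
      simp only [hφ]; linarith
    · filter_upwards [hl] with t ht
      have h1 := ht.norm.rpow_const (p := r) (Or.inr hr.le)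
      have h2 := ((ht.sub_const (g t)).norm.rpow_const (p := r) (Or.inr hr.le))
      have h3 := (h1.add_const (‖g t‖ ^ r)).sub h2
      rw [sub_self, norm_zero, Real.zero_rpow hr.ne', sub_zero, ← two_mul] at h3
      exact h3
  have hlim2 := hlim.const_sub (∫ t, 2 * ‖g t‖ ^ r ∂mes)
  rw [sub_self] at hlim2
  refine squeeze_zero' (Eventually.of_forall fun R => integral_nonneg fun t => by positivity) ?_
    hlim2
  filter_upwards [mem_Ico_of_nhdsLT] with R hR
  have hFr : Integrable (fun t => ‖F (R * unitPt t)‖ ^ r) mes :=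
    integrable_of_continuous ((continuous_dilate hF.1 hR).norm.rpow_const fun _ => Or.inr hr.le)
  have hm : AEStronglyMeasurable (fun t => ‖F (R * unitPt t) - g t‖ ^ r) mes :=
    (((continuous_dilate hF.1 hR).aestronglyMeasurable.sub hgm).norm.aemeasurable.pow_const
      r).aestronglyMeasurable
  have hD : Integrable (fun t => ‖F (R * unitPt t) - g t‖ ^ r) mes := by
    refine (hFr.add hg).mono' hm (Eventually.of_forall fun t => ?_)
    rw [Real.norm_of_nonneg (by positivity)]
    exact norm_sub_rpow_le hr hr1 _ _
  have h1 : ∫ t, φ R t ∂mes = (∫ t, ‖F (R * unitPt t)‖ ^ r ∂mes) + (∫ t, ‖g t‖ ^ r ∂mes)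
      - ∫ t, ‖F (R * unitPt t) - g t‖ ^ r ∂mes := by
    rw [← integral_add hFr hg]
    exact integral_sub (hFr.add hg) hD
  -- The means of `‖F‖ ^ r` do not exceed `∫ ‖g‖ ^ r`, so `∫ ‖F(R·) - g‖ ^ r ≤ 2 ∫ ‖g‖ ^ r - ∫ φ`,
  -- which tends to zero.
  have h2 := integral_norm_rpow_dilate_le hr hF.1 hg
    (fun w hw => norm_rpow_le_of_isRadialLimit hr hr1 hF hgm hg hl hw) hR
  rw [integral_const_mul, h1]
  linarith

/-! ### Polynomials, coboundaries and the value at the origin. -/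

theorem memLp_of_continuous (r : ℝ) {f : Torus → ℂ} (hf : Continuous f) :
    MemLp f (ENNReal.ofReal r) mes :=
  hf.memLp_of_hasCompactSupport (HasCompactSupport.of_compactSpace f)

theorem continuous_eval_unitPt (p : Polynomial ℂ) : Continuous fun t => p.eval (unitPt t) :=
  p.continuous.comp continuous_unitPt

/-- Polynomials, restricted to the circle, as elements of `L^r`. -/
noncomputable def polyLr (r : ℝ) : Polynomial ℂ →ₗ[ℂ] Lr r where
  toFun p := (memLp_of_continuous r (continuous_eval_unitPt p)).toLp _
  map_add' p q := by
    rw [← MemLp.toLp_add]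
    refine MemLp.toLp_congr _ _ (Eventually.of_forall fun t => ?_)
    simp
  map_smul' c p := by
    rw [RingHom.id_apply, ← MemLp.toLp_const_smul]
    refine MemLp.toLp_congr _ _ (Eventually.of_forall fun t => ?_)
    simp

theorem coeFn_polyLr (r : ℝ) (p : Polynomial ℂ) :
    polyLr r p =ᵐ[mes] fun t => p.eval (unitPt t) :=
  MemLp.coeFn_toLp (memLp_of_continuous r (continuous_eval_unitPt p))

theorem polyLr_C (r : ℝ) (c : ℂ) :
    polyLr r (Polynomial.C c) = Lp.const (ENNReal.ofReal r) mes c := by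
  refine Lp.ext ?_
  filter_upwards [coeFn_polyLr r (Polynomial.C c), Lp.coeFn_const (ENNReal.ofReal r) mes c]
    with t h1 h2
  rw [h1, h2, Polynomial.eval_C, Function.const_apply]

theorem memHardyDisc_of_differentiable {r : ℝ} (hr : 0 < r) (hr1 : r < 1) {F : ℂ → ℂ}
    (hF : Differentiable ℂ F) : MemHardyDisc r F :=
  memHardyDisc_of_le_poisson hr hF.differentiableOn
    (integrable_of_continuous ((hF.continuous.comp continuous_unitPt).norm.rpow_const
      fun _ => Or.inr hr.le))
    fun _ hw => norm_rpow_le_integral_poisson hF.diffContOnCl hr hr1.le hw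

theorem isRadialLimit_of_continuous {F : ℂ → ℂ} (hF : Continuous F) {g : Torus → ℂ}
    (hg : g =ᵐ[mes] fun t => F (unitPt t)) : IsRadialLimit F g := by
  filter_upwards [hg] with t ht
  rw [ht]
  have : Tendsto (fun R : ℝ => F (R * unitPt t)) (𝓝 1) (𝓝 (F ((1 : ℝ) * unitPt t))) :=
    Continuous.tendsto (by fun_prop) 1
  rw [Complex.ofReal_one, one_mul] at this
  exact this.mono_left nhdsWithin_le_nhds

theorem polyLr_mem_hardyCircle {r : ℝ} (hr : 0 < r) (hr1 : r < 1) (p : Polynomial ℂ) :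
    polyLr r p ∈ hardyCircle hr hr1 :=
  ⟨fun z => p.eval z, memHardyDisc_of_differentiable hr hr1 p.differentiable,
    isRadialLimit_of_continuous p.continuous (coeFn_polyLr r p)⟩

theorem const_mem_hardyCircle {r : ℝ} (hr : 0 < r) (hr1 : r < 1) (c : ℂ) :
    Lp.const (ENNReal.ofReal r) mes c ∈ hardyCircle hr hr1 := by
  rw [← polyLr_C]
  exact polyLr_mem_hardyCircle hr hr1 _

theorem coeFn_rotOp (r α : ℝ) (f : Lr r) :
    rotOp r α f =ᵐ[mes] fun t => f (t + (α : Torus)) :=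
  Lp.coeFn_compMeasurePreserving f (measurePreserving_add_right mes (α : Torus))

theorem MemHardyDisc.rotate {r : ℝ} {F : ℂ → ℂ} (hF : MemHardyDisc r F) (a : Torus) :
    MemHardyDisc r fun z => F (unitPt a * z) := by
  obtain ⟨A, hA⟩ := hF.exists_integral_le
  refine ⟨hF.1.comp (by fun_prop) fun z hz => ?_, A, ?_⟩
  · rw [mem_ball_zero_iff] at hz ⊢
    rwa [norm_mul, norm_unitPt, one_mul]
  · rintro _ ⟨R, hR, rfl⟩
    simp only
    rw [circleAverage_eq_integral]
    have h1 := integral_add_right_eq_self (μ := mes) (fun t => ‖F (R * unitPt t)‖ ^ r) a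
    refine le_trans (le_of_eq ?_) (hA R hR)
    rw [← h1]
    refine integral_congr_ae (Eventually.of_forall fun t => ?_)
    simp only [unitPt_add]
    congr 3
    ring

theorem IsRadialLimit.rotate {F : ℂ → ℂ} {g : Torus → ℂ} (hl : IsRadialLimit F g) (a : Torus) :
    IsRadialLimit (fun z => F (unitPt a * z)) fun t => g (t + a) := by
  filter_upwards [(measurePreserving_add_right mes a).quasiMeasurePreserving.ae hl] with t ht
  refine ht.congr fun R => ?_
  rw [show ((AddCircle.toCircle (t + a) : Circle) : ℂ) = unitPt t * unitPt a from unitPt_add t a]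
  congr 1
  ring

theorem IsRadialLimit.congr {F : ℂ → ℂ} {g h : Torus → ℂ} (hl : IsRadialLimit F g)
    (hgh : h =ᵐ[mes] g) : IsRadialLimit F h := by
  filter_upwards [hl, hgh] with t ht h1
  rwa [h1]

theorem rotOp_mem_hardyCircle {r : ℝ} (hr : 0 < r) (hr1 : r < 1) (α : ℝ) {g : Lr r}
    (hg : g ∈ hardyCircle hr hr1) : rotOp r α g ∈ hardyCircle hr hr1 := by
  obtain ⟨F, hF, hl⟩ := hg
  exact ⟨_, hF.rotate α, (hl.rotate α).congr (coeFn_rotOp r α g)⟩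

theorem coboundaries_le_hardyCircle {r : ℝ} (hr : 0 < r) (hr1 : r < 1) (α : ℝ) :
    coboundaries r α (hardyCircle hr hr1) ≤ hardyCircle hr hr1 := by
  rintro _ ⟨g, hg, rfl⟩
  exact Submodule.sub_mem _ hg (rotOp_mem_hardyCircle hr hr1 α hg)

theorem unitPt_pow_ne_one {α : ℝ} (hα : Irrational (α / (2 * Real.pi))) {n : ℕ} (hn : n ≠ 0) :
    unitPt (α : Torus) ^ n ≠ 1 := by
  rw [unitPt_coe, ← Complex.exp_nat_mul]
  intro h
  obtain ⟨k, hk⟩ := Complex.exp_eq_one_iff.mp h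
  have h1 : ((n * α : ℝ) : ℂ) = ((k * (2 * Real.pi) : ℝ) : ℂ) := by
    have := mul_right_cancel₀ Complex.I_ne_zero
      (show ((n * α : ℝ) : ℂ) * Complex.I = ((k * (2 * Real.pi) : ℝ) : ℂ) * Complex.I by
        push_cast; linear_combination hk)
    exact this
  have h2 : (n : ℝ) * α = k * (2 * Real.pi) := by exact_mod_cast h1
  refine hα ⟨(k : ℚ) / n, ?_⟩
  have hn' : (n : ℝ) ≠ 0 := Nat.cast_ne_zero.mpr hn
  have hpi := Real.two_pi_pos.ne'
  push_cast
  rw [div_eq_div_iff hn' hpi]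
  linarith

theorem rotOp_polyLr_monomial (r α : ℝ) (n : ℕ) (c : ℂ) :
    rotOp r α (polyLr r (Polynomial.monomial n c)) =
      unitPt (α : Torus) ^ n • polyLr r (Polynomial.monomial n c) := by
  refine Lp.ext ?_
  have h := (measurePreserving_add_right mes (α : Torus)).quasiMeasurePreserving.ae
    (coeFn_polyLr r (Polynomial.monomial n c))
  filter_upwards [coeFn_rotOp r α (polyLr r (Polynomial.monomial n c)), h,
    coeFn_polyLr r (Polynomial.monomial n c), Lp.coeFn_smul (unitPt (α : Torus) ^ n)
      (polyLr r (Polynomial.monomial n c))] with t h1 h2 h3 h4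
  rw [h1, h2, h4, Pi.smul_apply, h3, unitPt_add]
  simp only [Polynomial.eval_monomial, smul_eq_mul]
  ring

/-- For `n ≥ 1` the eigenvalue equation can be solved: `z^n = (I - T)(z^n / (1 - e^{inα}))`. Only
the constant term is an obstruction. -/
theorem polyLr_sub_const_mem_coboundaries {r : ℝ} (hr : 0 < r) (hr1 : r < 1) {α : ℝ}
    (hα : Irrational (α / (2 * Real.pi))) (p : Polynomial ℂ) :
    polyLr r p - Lp.const (ENNReal.ofReal r) mes (p.eval 0) ∈
      coboundaries r α (hardyCircle hr hr1) := by
  induction p using Polynomial.induction_on' with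
  | add p q hp hq =>
    have h := Submodule.add_mem _ hp hq
    rw [map_add, Polynomial.eval_add, map_add]
    convert h using 1
    abel
  | monomial n c =>
    rcases eq_or_ne n 0 with rfl | hn
    · rw [Polynomial.monomial_zero_left, polyLr_C, Polynomial.eval_C, sub_self]
      exact Submodule.zero_mem _
    · have h1 : (1 - unitPt (α : Torus) ^ n) ≠ 0 := sub_ne_zero.mpr (unitPt_pow_ne_one hα hn).symm
      have h2 : (Polynomial.monomial n c).eval 0 = 0 := by simp [hn]
      rw [h2, map_zero, sub_zero]
      refine ⟨(1 - unitPt (α : Torus) ^ n)⁻¹ • polyLr r (Polynomial.monomial n c),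
        Submodule.smul_mem _ _ (polyLr_mem_hardyCircle hr hr1 _), ?_⟩
      rw [map_smul, LinearMap.sub_apply, LinearMap.id_apply, rotOp_polyLr_monomial]
      nth_rewrite 1 [← one_smul ℂ (polyLr r (Polynomial.monomial n c))]
      rw [← sub_smul, smul_smul, inv_mul_cancel₀ h1, one_smul]

theorem exists_polynomial_near_dilate {F : ℂ → ℂ}
    (hF : DifferentiableOn ℂ F (Metric.ball 0 1)) {R : ℝ} (hR : R ∈ Set.Ico (0 : ℝ) 1) {δ : ℝ}
    (hδ : 0 < δ) : ∃ p : Polynomial ℂ, ∀ z : ℂ, ‖z‖ ≤ 1 → ‖F (R * z) - p.eval z‖ < δ := by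
  -- With `R < a < b < 1`, Cauchy's formula gives the power series on radius `b`, and it converges
  -- uniformly on the ball of radius `a`, which contains `R z` for `‖z‖ ≤ 1`.
  obtain ⟨a, ha, ha1⟩ := exists_between hR.2
  obtain ⟨b, hb, hb1⟩ := exists_between ha1
  have ha0 : 0 < a := hR.1.trans_lt ha
  lift a to NNReal using ha0.le
  lift b to NNReal using (ha0.trans hb).le
  have hps := (hF.mono (Metric.closedBall_subset_ball hb1)).hasFPowerSeriesOnBall
    (by exact_mod_cast ha0.trans hb)
  have hu := hps.tendstoUniformlyOn (r' := a) (by exact_mod_cast hb)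
  obtain ⟨n, hn⟩ := (Metric.tendstoUniformlyOn_iff.mp hu δ hδ).exists
  set c := cauchyPowerSeries F 0 b
  refine ⟨∑ k ∈ Finset.range n, Polynomial.monomial k (R ^ k * c.coeff k), fun z hz => ?_⟩
  have hz' : (R : ℂ) * z ∈ Metric.ball (0 : ℂ) a := by
    rw [mem_ball_zero_iff, norm_mul, Complex.norm_real, Real.norm_of_nonneg hR.1]
    exact (mul_le_of_le_one_right hR.1 hz).trans_lt ha
  have h1 := hn _ hz'
  rw [zero_add, dist_eq_norm] at h1
  suffices h : (∑ k ∈ Finset.range n, Polynomial.monomial k (R ^ k * c.coeff k)).eval z =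
      c.partialSum n (R * z) by rwa [h]
  rw [Polynomial.eval_finsetSum]
  unfold FormalMultilinearSeries.partialSum
  refine Finset.sum_congr rfl fun k _ => ?_
  rw [FormalMultilinearSeries.apply_eq_pow_smul_coeff, Polynomial.eval_monomial, smul_eq_mul,
    mul_pow]
  ring

/-- A boundary function minus the value at the origin is a limit of coboundaries of polynomials. -/
theorem sub_const_mem_lrClosure {r : ℝ} (hr : 0 < r) (hr1 : r < 1) {α : ℝ}
    (hα : Irrational (α / (2 * Real.pi))) {g : Lr r} {F : ℂ → ℂ} (hF : MemHardyDisc r F)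
    (hl : IsRadialLimit F g) :
    g - Lp.const (ENNReal.ofReal r) mes (F 0) ∈
      lrClosure hr hr1 (coboundaries r α (hardyCircle hr hr1)) := by
  intro ε hε
  have hlim := tendsto_integral_dilate_sub hr hr1 hF (Lp.aestronglyMeasurable g)
    (integrable_norm_rpow hr g) hl
  obtain ⟨R, hR1, hR⟩ := ((hlim.eventually_lt_const (show 0 < ε / 3 by positivity)).and
    mem_Ico_of_nhdsLT).exists
  -- Three errors of `ε / 3` in the `r`-th power: dilate against `g`, polynomial against dilate on
  -- the circle, and the same at the origin.
  set δ := (ε / 3) ^ r⁻¹ with hδ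
  have hδ0 : 0 < δ := by positivity
  have hδr : δ ^ r = ε / 3 := Real.rpow_inv_rpow (by positivity) hr.ne'
  obtain ⟨p, hp⟩ := exists_polynomial_near_dilate hF.1 hR hδ0
  refine ⟨_, polyLr_sub_const_mem_coboundaries hr hr1 hα p, ?_⟩
  have hFc := continuous_dilate hF.1 hR
  have hm : AEStronglyMeasurable (fun t => ‖F (R * unitPt t) - g t‖ ^ r) mes :=
    ((hFc.aestronglyMeasurable.sub (Lp.aestronglyMeasurable g)).norm.aemeasurable.pow_const
      r).aestronglyMeasurable
  have hD : Integrable (fun t => ‖F (R * unitPt t) - g t‖ ^ r) mes := by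
    refine ((integrable_of_continuous (hFc.norm.rpow_const fun _ => Or.inr hr.le)).add
      (integrable_norm_rpow hr g)).mono' hm (Eventually.of_forall fun t => ?_)
    rw [Real.norm_of_nonneg (by positivity)]
    exact norm_sub_rpow_le hr hr1 _ _
  have hpt : ∀ z : ℂ, ‖z‖ ≤ 1 → ‖F (R * z) - p.eval z‖ ^ r ≤ ε / 3 := fun z hz => by
    rw [← hδr]
    exact Real.rpow_le_rpow (norm_nonneg _) (hp z hz).le hr.le
  have h0 := hpt 0 (by simp)
  rw [mul_zero] at h0
  have hmain : lrDist r (g - Lp.const (ENNReal.ofReal r) mes (F 0))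
      (polyLr r p - Lp.const (ENNReal.ofReal r) mes (p.eval 0)) ≤
      ∫ t, (‖F (R * unitPt t) - g t‖ ^ r + (ε / 3 + ε / 3)) ∂mes := by
    refine integral_mono_ae (integrable_norm_sub_rpow hr _ _) (hD.add (integrable_const _)) ?_
    filter_upwards [Lp.coeFn_sub g (Lp.const (ENNReal.ofReal r) mes (F 0)),
      Lp.coeFn_sub (polyLr r p) (Lp.const (ENNReal.ofReal r) mes (p.eval 0)),
      Lp.coeFn_const (ENNReal.ofReal r) mes (F 0),
      Lp.coeFn_const (ENNReal.ofReal r) mes (p.eval 0), coeFn_polyLr r p] with t h1 h2 h3 h4 h5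
    simp only [h1, h2, h3, h4, h5, Pi.sub_apply, Function.const_apply]
    have e : g t - F 0 - (p.eval (unitPt t) - p.eval 0) =
        (F (R * unitPt t) - p.eval (unitPt t)) - (F 0 - p.eval 0) - (F (R * unitPt t) - g t) := by
      ring
    rw [e]
    have i1 := norm_sub_rpow_le hr hr1
      ((F (R * unitPt t) - p.eval (unitPt t)) - (F 0 - p.eval 0)) (F (R * unitPt t) - g t)
    have i2 := norm_sub_rpow_le hr hr1 (F (R * unitPt t) - p.eval (unitPt t)) (F 0 - p.eval 0)
    have i3 := hpt (unitPt t) (norm_unitPt t).le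
    linarith
  refine hmain.trans_lt ?_
  rw [integral_add hD (integrable_const _), integral_const, probReal_univ, one_smul]
  linarith

/-- Evaluation at the origin is continuous for the metric of `L^r`. -/
theorem eq_zero_of_const_mem_lrClosure {r : ℝ} (hr : 0 < r) (hr1 : r < 1) {α : ℝ} {c : ℂ}
    (hc : Lp.const (ENNReal.ofReal r) mes c ∈
      lrClosure hr hr1 (coboundaries r α (hardyCircle hr hr1))) : c = 0 := by
  have key : ∀ ε > 0, ‖c‖ ^ r ≤ 0 + ε := by
    intro ε hε
    obtain ⟨_, ⟨g, ⟨F, hF, hl⟩, rfl⟩, hd⟩ := hc ε hε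
    change lrDist r _ (g - rotOp r α g) < ε at hd
    -- `G` extends `c - (g - Tg)` and `G 0 = c`, since the two values of `F` at the origin cancel.
    -- The Poisson kernel at `0` is identically one, so the bound at `0` reads `‖c‖ ^ r ≤ d(c, g -
    -- Tg)`.
    set G : ℂ → ℂ :=
      (fun _ => c) + (-1 : ℂ) • (F + (-1 : ℂ) • fun z => F (unitPt (α : Torus) * z)) with hGdef
    have hG : MemHardyDisc r G :=
      (memHardyDisc_of_differentiable hr hr1 (differentiable_const c)).add hr hr1
        ((hF.add hr hr1 ((hF.rotate α).smul (-1))).smul (-1))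
    set k := Lp.const (ENNReal.ofReal r) mes c - (g - rotOp r α g) with hk
    have hGl : IsRadialLimit G k := by
      filter_upwards [hl, hl.rotate (α : Torus), coeFn_rotOp r α g,
        Lp.coeFn_const (ENNReal.ofReal r) mes c,
        Lp.coeFn_sub (Lp.const (ENNReal.ofReal r) mes c) ((g - rotOp r α g)),
        Lp.coeFn_sub g (rotOp r α g)] with t h1 h2 h3 h4 h5 h6
      have h7 : k t = c + (-1 : ℂ) • (g t + (-1 : ℂ) • g (t + (α : Torus))) := by
        rw [hk, h5, Pi.sub_apply, h4, h6, Pi.sub_apply, h3]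
        simp only [Function.const_apply, smul_eq_mul]
        ring
      rw [h7]
      exact tendsto_const_nhds.add ((h1.add (h2.const_smul _)).const_smul _)
    have h1 := norm_rpow_le_of_isRadialLimit hr hr1 hG (Lp.aestronglyMeasurable k)
      (integrable_norm_rpow hr k) hGl (w := 0) (by simp)
    have h2 : ∫ t, poisson 0 t * ‖k t‖ ^ r ∂mes =
        lrDist r (Lp.const (ENNReal.ofReal r) mes c) ((g - rotOp r α g)) := by
      refine integral_congr_ae ?_
      filter_upwards [Lp.coeFn_sub (Lp.const (ENNReal.ofReal r) mes c)
        ((g - rotOp r α g))] with t h5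
      rw [hk, h5, Pi.sub_apply]
      simp [poisson, norm_unitPt]
    rw [h2] at h1
    have h3 : G 0 = c := by simp [hGdef]
    rw [h3] at h1
    linarith
  have h0 : ‖c‖ ^ r ≤ 0 := le_of_forall_pos_le_add key
  by_contra hne
  have := Real.rpow_pos_of_pos (norm_pos_iff.mpr hne) r
  linarith

/-! ### Radial growth of Poisson integrals. -/

/-- Jordan's inequality for the sine, applied to `|e^{iy} - 1| = 2 |sin (y / 2)|`. -/
theorem norm_le_norm_unitPt_sub_one (s : Torus) : 2 / Real.pi * ‖s‖ ≤ ‖unitPt s - 1‖ := by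
  obtain ⟨y, hy1, hy2, rfl⟩ : ∃ y : ℝ, -Real.pi < y ∧ y ≤ Real.pi ∧ (y : Torus) = s := by
    refine ⟨Complex.arg (unitPt s), Complex.neg_pi_lt_arg _, Complex.arg_le_pi _, ?_⟩
    refine AddCircle.injective_toCircle Real.two_pi_pos.ne' (Subtype.ext ?_)
    have h := Complex.norm_mul_exp_arg_mul_I (unitPt s)
    rwa [norm_unitPt, Complex.ofReal_one, one_mul, ← unitPt_coe] at h
  have h1 : ‖(y : Torus)‖ ≤ |y| := QuotientAddGroup.norm_mk_le_norm
  have h2 : ‖unitPt (y : Torus) - 1‖ = |2 * Real.sin (y / 2)| := by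
    rw [unitPt_coe, mul_comm, Complex.norm_exp_I_mul_ofReal_sub_one, Real.norm_eq_abs]
  have h3 : 2 / Real.pi * (|y| / 2) ≤ Real.sin (|y| / 2) :=
    Real.mul_le_sin (by positivity) (by have := abs_le.mpr ⟨hy1.le, hy2⟩; linarith)
  have h4 : Real.sin (|y| / 2) ≤ |Real.sin (y / 2)| := by
    rcases abs_choice y with h | h <;> rw [h]
    · exact le_abs_self _
    · rw [neg_div, Real.sin_neg]; exact neg_le_abs _
  rw [h2, abs_mul, abs_two]
  have hpi := Real.pi_pos
  calc 2 / Real.pi * ‖(y : Torus)‖ ≤ 2 / Real.pi * |y| := by gcongr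
    _ = 2 * (2 / Real.pi * (|y| / 2)) := by ring
    _ ≤ _ := by linarith

/-- From `|e^{is} - R|² = (1 - R)² + R |e^{is} - 1|²`. The constant `1 / 5` combines `R ≥ 1 / 2`
with `4 / π² ≥ 2 / 5`. -/
theorem le_norm_unitPt_sub_sq {R : ℝ} (hR : 1 / 2 ≤ R) (x t : Torus) :
    (1 - R) ^ 2 + dist x t ^ 2 / 5 ≤ ‖unitPt x - R * unitPt t‖ ^ 2 := by
  set s := x - t
  have hx : unitPt x = unitPt s * unitPt t := by rw [← unitPt_add, sub_add_cancel]
  have h1 : ‖unitPt x - R * unitPt t‖ = ‖unitPt s - R‖ := by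
    rw [hx, ← sub_mul, norm_mul, norm_unitPt, mul_one]
  have h2 : ‖unitPt s - R‖ ^ 2 = (1 - R) ^ 2 + R * ‖unitPt s - 1‖ ^ 2 := by
    have ha : (unitPt s).re * (unitPt s).re + (unitPt s).im * (unitPt s).im = 1 := by
      rw [← Complex.normSq_apply, Complex.normSq_eq_norm_sq, norm_unitPt, one_pow]
    rw [← Complex.normSq_eq_norm_sq, ← Complex.normSq_eq_norm_sq, Complex.normSq_apply,
      Complex.normSq_apply]
    simp only [Complex.sub_re, Complex.sub_im, Complex.ofReal_re, Complex.ofReal_im, Complex.one_re,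
      Complex.one_im, sub_zero]
    linear_combination (1 - R) * ha
  have h3 := norm_le_norm_unitPt_sub_one s
  have h4 : dist x t = ‖s‖ := dist_eq_norm x t
  have hpi := Real.pi_pos
  have h5 : (2 / Real.pi * ‖s‖) ^ 2 ≤ ‖unitPt s - 1‖ ^ 2 := by gcongr
  have h6 : Real.pi ^ 2 ≤ 10 := by nlinarith [Real.pi_lt_d2]
  have h7 : 2 / 5 * ‖s‖ ^ 2 ≤ (2 / Real.pi * ‖s‖) ^ 2 := by
    rw [mul_pow, div_pow]
    refine mul_le_mul_of_nonneg_right ?_ (sq_nonneg _)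
    rw [div_le_div_iff₀ (by norm_num) (by positivity)]
    linarith
  rw [h1, h2, h4]
  nlinarith [sq_nonneg ‖unitPt s - 1‖]

theorem poisson_mul_le {R : ℝ} (hR : 1 / 2 ≤ R) (hR1 : R < 1) (x t : Torus) :
    poisson (R * unitPt t) x * ((1 - R) ^ 2 + dist x t ^ 2) ≤ 10 * (1 - R) := by
  have h1 := le_norm_unitPt_sub_sq hR x t
  have h2 : 0 < 1 - R := by linarith
  have h3 : 0 < ‖unitPt x - R * unitPt t‖ ^ 2 := lt_of_lt_of_le (by positivity) h1
  rw [poisson, norm_ofReal_mul_unitPt (by linarith), div_mul_eq_mul_div, div_le_iff₀ h3]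
  have h4 : 1 - R ^ 2 ≤ 2 * (1 - R) := by nlinarith
  calc (1 - R ^ 2) * ((1 - R) ^ 2 + dist x t ^ 2)
      ≤ 2 * (1 - R) * ((1 - R) ^ 2 + dist x t ^ 2) := by gcongr
    _ ≤ 2 * (1 - R) * (5 * ((1 - R) ^ 2 + dist x t ^ 2 / 5)) := by
        gcongr
        nlinarith [sq_nonneg (1 - R)]
    _ ≤ 2 * (1 - R) * (5 * ‖unitPt x - R * unitPt t‖ ^ 2) := by gcongr
    _ = _ := by ring

/-- The Poisson kernel is dominated by a combination of indicators of balls of dyadic radii. -/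
theorem poisson_le_sum_dyadic {R : ℝ} (hR : 1 / 2 ≤ R) (hR1 : R < 1) (x t : Torus) (K : ℕ) :
    poisson (R * unitPt t) x ≤ (∑ k ∈ Finset.range (K + 1), 40 / (4 ^ k * (1 - R)) *
      (Metric.closedBall t (2 ^ k * (1 - R))).indicator 1 x) + 10 / (4 ^ K * (1 - R)) := by
  have h0 : 0 < 1 - R := by linarith
  have hP := poisson_mul_le hR hR1 x t
  have hP0 : 0 < poisson (R * unitPt t) x :=
    poisson_pos (norm_ofReal_mul_lt_one ⟨by linarith, hR1⟩ (norm_unitPt t).le) x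
  have hnn : ∀ k : ℕ, (0 : ℝ) ≤ 40 / (4 ^ k * (1 - R)) *
      (Metric.closedBall t (2 ^ k * (1 - R))).indicator 1 x := fun k =>
    mul_nonneg (by positivity) (Set.indicator_nonneg (fun _ _ => zero_le_one) _)
  -- The last term bounds the kernel outside the ball of radius `2 ^ K * (1 - R)`. In passing to `K
  -- + 1`, the new summand `40 / 4 ^ (K + 1)` equals the old tail `10 / 4 ^ K` inside the new ball;
  -- outside it the decay of the kernel gives the new tail.
  induction K with
  | zero =>
    have h1 : poisson (R * unitPt t) x ≤ 10 / (4 ^ 0 * (1 - R)) := by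
      rw [pow_zero, one_mul, le_div_iff₀ h0]
      have h2 : poisson (R * unitPt t) x * (1 - R) ^ 2 ≤ 10 * (1 - R) :=
        le_trans (mul_le_mul_of_nonneg_left (by nlinarith [sq_nonneg (dist x t)]) hP0.le) hP
      by_contra hcon
      push Not at hcon
      nlinarith
    have h2 := Finset.sum_nonneg fun k (_ : k ∈ Finset.range (0 + 1)) => hnn k
    linarith
  | succ K ih =>
    by_cases hd : x ∈ Metric.closedBall t (2 ^ (K + 1) * (1 - R))
    · rw [Finset.sum_range_succ, Set.indicator_of_mem hd, Pi.one_apply, mul_one]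
      have e : 40 / (4 ^ (K + 1) * (1 - R)) = 10 / (4 ^ K * (1 - R)) := by
        rw [pow_succ]; field_simp; norm_num
      have h3 : 0 < 10 / (4 ^ (K + 1) * (1 - R)) := by positivity
      linarith
    · have h2 := Finset.sum_nonneg fun k (_ : k ∈ Finset.range (K + 1 + 1)) => hnn k
      rw [Metric.mem_closedBall, not_le] at hd
      have h3 : (2 ^ (K + 1) * (1 - R)) ^ 2 ≤ dist x t ^ 2 := by gcongr
      have e : ((2 : ℝ) ^ (K + 1)) ^ 2 = 4 ^ (K + 1) := by
        rw [← pow_mul, mul_comm, pow_mul]; norm_num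
      rw [mul_pow, e] at h3
      have h4 : poisson (R * unitPt t) x ≤ 10 / (4 ^ (K + 1) * (1 - R)) := by
        rw [le_div_iff₀ (by positivity)]
        have h5 : poisson (R * unitPt t) x * (4 ^ (K + 1) * (1 - R) ^ 2) ≤ 10 * (1 - R) :=
          le_trans (mul_le_mul_of_nonneg_left (by nlinarith [sq_nonneg (1 - R)]) hP0.le) hP
        by_contra hcon
        push Not at hcon
        nlinarith
      linarith

/-- Take `K` with `2 ^ K * (1 - R) ≤ δ < 2 ^ (K + 1) * (1 - R)`, so that all dyadic balls have
radius at most `δ`. The `k`-th contributes at most `40 * A / 2 ^ k`, in total `80 * A`; the choice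
of `K` turns the tail into the term with `1 - R`. -/
theorem integral_poisson_le_of_ball_bound {h : Torus → ℝ} (hh : Integrable h mes)
    (h0 : ∀ x, 0 ≤ h x) {t : Torus} {δ A : ℝ} (hδ : 0 < δ) (hA : 0 ≤ A)
    (hball : ∀ ρ, 0 < ρ → ρ ≤ δ → ∫ x in Metric.closedBall t ρ, h x ∂mes ≤ A * ρ)
    {R : ℝ} (hR : 1 / 2 ≤ R) (hR1 : R < 1) (hRδ : 1 - R ≤ δ) :
    ∫ x, poisson (R * unitPt t) x * h x ∂mes ≤
      80 * A + (40 * (∫ x, h x ∂mes) / δ ^ 2) * (1 - R) := by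
  have hε : 0 < 1 - R := by linarith
  have hI : 0 ≤ ∫ x, h x ∂mes := integral_nonneg h0
  obtain ⟨K, hK1, hK2⟩ := exists_nat_pow_near (x := δ / (1 - R)) (y := (2 : ℝ))
    ((one_le_div hε).mpr hRδ) one_lt_two
  rw [le_div_iff₀ hε] at hK1
  rw [div_lt_iff₀ hε] at hK2
  have hind : ∀ k : ℕ, Integrable
      ((Metric.closedBall t (2 ^ k * (1 - R))).indicator h) mes := fun k =>
    hh.indicator Metric.isClosed_closedBall.measurableSet
  have hfin : Integrable (fun x => ∑ k ∈ Finset.range (K + 1), 40 / (4 ^ k * (1 - R)) *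
      (Metric.closedBall t (2 ^ k * (1 - R))).indicator h x) mes :=
    integrable_finsetSum _ fun k _ => (hind k).const_mul _
  have h1 : ∫ x, poisson (R * unitPt t) x * h x ∂mes ≤
      ∫ x, ((∑ k ∈ Finset.range (K + 1), 40 / (4 ^ k * (1 - R)) *
        (Metric.closedBall t (2 ^ k * (1 - R))).indicator h x) +
          10 / (4 ^ K * (1 - R)) * h x) ∂mes := by
    refine integral_mono (integrable_poisson_mul (norm_ofReal_mul_lt_one ⟨by linarith, hR1⟩
      (norm_unitPt t).le) hh) (hfin.add (hh.const_mul _)) fun x => ?_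
    refine (mul_le_mul_of_nonneg_right (poisson_le_sum_dyadic hR hR1 x t K) (h0 x)).trans
      (le_of_eq ?_)
    rw [add_mul, Finset.sum_mul]
    congr 1
    refine Finset.sum_congr rfl fun k _ => ?_
    rw [mul_assoc]
    congr 1
    by_cases hx : x ∈ Metric.closedBall t (2 ^ k * (1 - R)) <;> simp [hx]
  rw [integral_add hfin (hh.const_mul _), integral_finsetSum _
    (fun k _ => (hind k).const_mul _), integral_const_mul] at h1
  have h2 : ∑ k ∈ Finset.range (K + 1), ∫ x, 40 / (4 ^ k * (1 - R)) *
      (Metric.closedBall t (2 ^ k * (1 - R))).indicator h x ∂mes ≤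
      ∑ k ∈ Finset.range (K + 1), 40 * A * (1 / 2) ^ k := by
    refine Finset.sum_le_sum fun k hk => ?_
    rw [integral_const_mul, integral_indicator Metric.isClosed_closedBall.measurableSet]
    have hk' : k ≤ K := Nat.lt_succ_iff.mp (Finset.mem_range.mp hk)
    have h3 := hball (2 ^ k * (1 - R)) (by positivity)
      (le_trans (mul_le_mul_of_nonneg_right (pow_le_pow_right₀ one_le_two hk') hε.le) hK1)
    calc _ ≤ 40 / (4 ^ k * (1 - R)) * (A * (2 ^ k * (1 - R))) := by gcongr
      _ = 40 * A * (2 ^ k / 4 ^ k) := by field_simp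
      _ = _ := by rw [← div_pow]; norm_num
  have h3 : ∑ k ∈ Finset.range (K + 1), 40 * A * (1 / 2 : ℝ) ^ k ≤ 80 * A := by
    rw [← Finset.mul_sum]
    have := sum_geometric_two_le (K + 1)
    nlinarith
  have h4 : 10 / (4 ^ K * (1 - R)) * ∫ x, h x ∂mes ≤
      (40 * (∫ x, h x ∂mes) / δ ^ 2) * (1 - R) := by
    have e : (4 : ℝ) ^ K = (2 ^ K) ^ 2 := by rw [← pow_mul, mul_comm, pow_mul]; norm_num
    have h5 : δ ^ 2 ≤ 4 * (4 ^ K * (1 - R) ^ 2) := by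
      have : δ ^ 2 ≤ (2 ^ (K + 1) * (1 - R)) ^ 2 := by gcongr
      rw [e]
      calc _ ≤ _ := this
        _ = _ := by ring
    have h6 : 10 / (4 ^ K * (1 - R)) ≤ 40 / δ ^ 2 * (1 - R) := by
      rw [div_mul_eq_mul_div, div_le_div_iff₀ (by positivity) (by positivity)]
      nlinarith
    calc _ ≤ 40 / δ ^ 2 * (1 - R) * ∫ x, h x ∂mes := by gcongr
      _ = _ := by ring
  linarith

/-- Lebesgue's differentiation theorem. A ball of radius `ρ` has normalized measure at most `ρ / π`,
and the factor `1 / π` is given away. -/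
theorem ae_ball_bound {h : Torus → ℝ} (hh : Integrable h mes) :
    ∀ᵐ t ∂mes, ∀ η > 0, ∃ δ > 0, ∀ ρ, 0 < ρ → ρ ≤ δ → 0 ≤ h t →
      ∫ x in Metric.closedBall t ρ, h x ∂mes ≤ (h t + η) * ρ := by
  have hv : (volume : Measure Torus) = ENNReal.ofReal (2 * Real.pi) • mes :=
    AddCircle.volume_eq_smul_haarAddCircle
  have hh' : Integrable h (volume : Measure Torus) := by
    rw [hv]; exact hh.smul_measure ENNReal.ofReal_ne_top
  have hac : mes ≪ (volume : Measure Torus) := by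
    rw [hv]
    exact Measure.absolutelyContinuous_smul (by simp [Real.pi_pos])
  filter_upwards [hac.ae_le (IsUnifLocDoublingMeasure.ae_tendsto_average
    (volume : Measure Torus) hh'.locallyIntegrable 1)] with t ht η hη
  have hlim := ht (fun _ : ℝ => t) (fun ρ => ρ) (l := 𝓝[>] 0) tendsto_id
    (eventually_mem_nhdsWithin.mono fun ρ hρ => by
      rw [one_mul]; exact Metric.mem_closedBall_self (le_of_lt hρ))
  have hev := hlim.eventually_lt_const (show h t < h t + η by linarith)
  obtain ⟨δ, hδ, hsub⟩ := (mem_nhdsGT_iff_exists_Ioc_subset).mp hev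
  refine ⟨δ, hδ, fun ρ hρ hρδ hpos => ?_⟩
  have h1 : ⨍ y in Metric.closedBall t ρ, h y ∂(volume : Measure Torus) < h t + η :=
    hsub ⟨hρ, hρδ⟩
  have h2 := measure_smul_setAverage (μ := (volume : Measure Torus)) h
    (s := Metric.closedBall t ρ) (measure_ne_top _ _)
  have h3 : ∫ x in Metric.closedBall t ρ, h x ∂(volume : Measure Torus) =
      2 * Real.pi * ∫ x in Metric.closedBall t ρ, h x ∂mes := by
    rw [hv, Measure.restrict_smul, integral_smul_measure,
      ENNReal.toReal_ofReal Real.two_pi_pos.le, smul_eq_mul]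
  have h4 : (volume : Measure Torus).real (Metric.closedBall t ρ) ≤ 2 * ρ := by
    rw [measureReal_def, AddCircle.volume_closedBall]
    rw [ENNReal.toReal_ofReal (le_min Real.two_pi_pos.le (by linarith))]
    exact min_le_right _ _
  rw [h3, smul_eq_mul] at h2
  have h5 : 2 * Real.pi * ∫ x in Metric.closedBall t ρ, h x ∂mes ≤ 2 * ρ * (h t + η) := by
    rw [← h2]
    calc _ ≤ (volume : Measure Torus).real (Metric.closedBall t ρ) * (h t + η) := by gcongr
      _ ≤ _ := mul_le_mul_of_nonneg_right h4 (by linarith)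
  have hpi := Real.pi_gt_three
  have h6 : 0 ≤ (h t + η) * ρ := mul_nonneg (by linarith) hρ.le
  nlinarith

/-- Almost everywhere, the radial upper limit of a Poisson integral is at most a constant times the
boundary value. -/
theorem ae_eventually_integral_poisson_le {h : Torus → ℝ} (hh : Integrable h mes)
    (h0 : ∀ x, 0 ≤ h x) : ∀ᵐ t ∂mes, ∀ η > 0, ∀ᶠ R : ℝ in 𝓝[<] 1,
      ∫ x, poisson (R * unitPt t) x * h x ∂mes ≤ 80 * h t + η := by
  filter_upwards [ae_ball_bound hh] with t ht η hη
  -- The factor `80` turns `η / 160` into `η / 2`; the other half absorbs the term with `1 - R`.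
  obtain ⟨δ, hδ, hb⟩ := ht (η / 160) (by positivity)
  have hlim : Tendsto (fun R : ℝ => (40 * (∫ x, h x ∂mes) / δ ^ 2) * (1 - R)) (𝓝[<] 1)
      (𝓝 ((40 * (∫ x, h x ∂mes) / δ ^ 2) * (1 - 1))) :=
    (Continuous.tendsto (by fun_prop) 1).mono_left nhdsWithin_le_nhds
  rw [sub_self, mul_zero] at hlim
  have hm : max (1 / 2) (1 - δ) < (1 : ℝ) := max_lt (by norm_num) (by linarith)
  filter_upwards [hlim.eventually_lt_const (half_pos hη), Ioo_mem_nhdsLT hm] with R h1 h2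
  have h3 := max_lt_iff.mp h2.1
  have h4 := integral_poisson_le_of_ball_bound hh h0 hδ
    (show 0 ≤ h t + η / 160 by have := h0 t; positivity)
    (fun ρ hρ hρδ => hb ρ hρ hρδ (h0 t)) h3.1.le h2.2 (by linarith [h3.2])
  linarith

/-! ### Closedness of `H^r(𝕋)`. -/

theorem MemHardyDisc.sub {r : ℝ} (hr : 0 < r) (hr1 : r < 1) {F G : ℂ → ℂ}
    (hF : MemHardyDisc r F) (hG : MemHardyDisc r G) : MemHardyDisc r (fun z => F z - G z) := by
  have h := hF.add hr hr1 (hG.smul (-1))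
  have e : F + (-1 : ℂ) • G = fun z => F z - G z := by
    funext z; simp [sub_eq_add_neg]
  rwa [e] at h

/-- Nonnegative functions `h n` with `∫ h n → 0` have infimum zero almost everywhere. -/
theorem ae_exists_lt_of_tendsto_integral {h : ℕ → Torus → ℝ} (hh : ∀ n, Integrable (h n) mes)
    (h0 : ∀ n x, 0 ≤ h n x) (hlim : Tendsto (fun n => ∫ x, h n x ∂mes) atTop (𝓝 0)) :
    ∀ᵐ t ∂mes, ∀ η > 0, ∃ n, h n t < η := by
  have hm : AEMeasurable (fun t => ⨅ n, ENNReal.ofReal (h n t)) mes :=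
    AEMeasurable.iInf fun n => (hh n).aemeasurable.ennreal_ofReal
  have hz : ∫⁻ t, ⨅ n, ENNReal.ofReal (h n t) ∂mes = 0 := by
    refine le_antisymm ?_ zero_le
    have hl : Tendsto (fun n => ENNReal.ofReal (∫ x, h n x ∂mes)) atTop (𝓝 (ENNReal.ofReal 0)) :=
      ENNReal.tendsto_ofReal hlim
    rw [ENNReal.ofReal_zero] at hl
    refine ge_of_tendsto' hl fun n => ?_
    rw [ofReal_integral_eq_lintegral_ofReal (hh n) (Eventually.of_forall (h0 n))]
    exact lintegral_mono fun t => iInf_le _ n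
  filter_upwards [(lintegral_eq_zero_iff' hm).mp hz] with t ht η hη
  have h1 : ⨅ n, ENNReal.ofReal (h n t) < ENNReal.ofReal η := by
    rw [ht]; exact ENNReal.ofReal_pos.mpr hη
  obtain ⟨n, hn⟩ := iInf_lt_iff.mp h1
  exact ⟨n, (ENNReal.ofReal_lt_ofReal_iff hη).mp hn⟩

theorem integral_poisson_mul_le {w : ℂ} (hw : ‖w‖ < 1) {h : Torus → ℝ} (hh : Integrable h mes)
    (h0 : ∀ x, 0 ≤ h x) :
    ∫ t, poisson w t * h t ∂mes ≤ 2 / (1 - ‖w‖) * ∫ t, h t ∂mes := by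
  rw [← integral_const_mul]
  refine integral_mono (integrable_poisson_mul hw hh) (hh.const_mul _) fun t => ?_
  exact mul_le_mul_of_nonneg_right (poisson_le hw t) (h0 t)

theorem norm_le_of_rpow_le {r : ℝ} (hr : 0 < r) {a : ℂ} {b : ℝ} (hab : ‖a‖ ^ r ≤ b) :
    ‖a‖ ≤ b ^ r⁻¹ := by
  calc ‖a‖ = (‖a‖ ^ r) ^ r⁻¹ := (Real.rpow_rpow_inv (norm_nonneg a) hr.ne').symm
    _ ≤ _ := Real.rpow_le_rpow (by positivity) hab (by positivity)

theorem tendsto_rpow_inv_zero {r : ℝ} (hr : 0 < r) {ι : Type*} {l : Filter ι} {b : ι → ℝ}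
    (hb : Tendsto b l (𝓝 0)) : Tendsto (fun n => b n ^ r⁻¹) l (𝓝 0) := by
  have h := hb.rpow_const (p := r⁻¹) (Or.inr (by positivity))
  rwa [Real.zero_rpow (by positivity)] at h

/-- A sequence of holomorphic functions on the disc whose mutual distances are controlled by Poisson
integrals of functions tending to zero in mean converges to a holomorphic function. -/
theorem exists_limit_of_poisson_cauchy {r : ℝ} (hr : 0 < r) {F : ℕ → ℂ → ℂ}
    (hF : ∀ n, DifferentiableOn ℂ (F n) (Metric.ball 0 1)) {h : ℕ → Torus → ℝ}
    (hh : ∀ n, Integrable (h n) mes) (h0 : ∀ n x, 0 ≤ h n x)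
    (hlim : Tendsto (fun n => ∫ x, h n x ∂mes) atTop (𝓝 0))
    (hle : ∀ n m w, ‖w‖ < 1 → ‖F n w - F m w‖ ^ r ≤
      (∫ t, poisson w t * h n t ∂mes) + ∫ t, poisson w t * h m t ∂mes) :
    ∃ G : ℂ → ℂ, DifferentiableOn ℂ G (Metric.ball 0 1) ∧
      ∀ n w, ‖w‖ < 1 → ‖G w - F n w‖ ^ r ≤ ∫ t, poisson w t * h n t ∂mes := by
  have hP : ∀ w : ℂ, ‖w‖ < 1 →
      Tendsto (fun n => ∫ t, poisson w t * h n t ∂mes) atTop (𝓝 0) := by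
    intro w hw
    have h1 := hlim.const_mul (2 / (1 - ‖w‖))
    rw [mul_zero] at h1
    exact squeeze_zero (fun n => integral_nonneg fun t =>
      mul_nonneg (poisson_pos hw t).le (h0 n t)) (fun n => integral_poisson_mul_le hw (hh n) (h0 n))
      h1
  have hc : ∀ w : ℂ, ‖w‖ < 1 → ∃ z, Tendsto (fun n => F n w) atTop (𝓝 z) := by
    intro w hw
    refine cauchySeq_tendsto_of_complete ?_
    rw [Metric.cauchySeq_iff]
    intro ε hε
    have hε' : 0 < ε ^ r / 2 := by positivity
    obtain ⟨N, hN⟩ := eventually_atTop.mp ((hP w hw).eventually_lt_const hε')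
    refine ⟨N, fun m hm n hn => ?_⟩
    rw [dist_eq_norm, ← Real.rpow_lt_rpow_iff (norm_nonneg _) hε.le hr]
    have := hle m n w hw
    have h1 := hN m hm
    have h2 := hN n hn
    linarith
  choose! G hG using hc
  have hb : ∀ n w, ‖w‖ < 1 → ‖G w - F n w‖ ^ r ≤ ∫ t, poisson w t * h n t ∂mes := by
    intro n w hw
    have h1 : Tendsto (fun m => ‖F m w - F n w‖ ^ r) atTop (𝓝 (‖G w - F n w‖ ^ r)) :=
      ((hG w hw).sub_const _).norm.rpow_const (Or.inr hr.le)
    have h2 := (hP w hw).add_const (∫ t, poisson w t * h n t ∂mes)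
    rw [zero_add] at h2
    exact le_of_tendsto_of_tendsto' h1 h2 fun m => hle m n w hw
  refine ⟨G, ?_, hb⟩
  -- On a ball of radius `ρ < 1` the Poisson kernel is at most `2 / (1 - ρ)`, so convergence of the
  -- means to zero makes the convergence uniform there.
  refine TendstoLocallyUniformlyOn.differentiableOn (F := F) (φ := atTop) ?_
    (Eventually.of_forall hF) Metric.isOpen_ball
  rw [Metric.tendstoLocallyUniformlyOn_iff]
  intro ε hε x hx
  rw [mem_ball_zero_iff] at hx
  obtain ⟨ρ, hρ, hρ1⟩ := exists_between hx
  refine ⟨Metric.ball 0 ρ, mem_nhdsWithin_of_mem_nhds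
    (Metric.isOpen_ball.mem_nhds (mem_ball_zero_iff.mpr hρ)), ?_⟩
  have h1 := hlim.const_mul (2 / (1 - ρ))
  rw [mul_zero] at h1
  filter_upwards [(tendsto_rpow_inv_zero hr h1).eventually_lt_const hε] with n hn w hw
  rw [mem_ball_zero_iff] at hw
  have hw1 : ‖w‖ < 1 := hw.trans hρ1
  rw [dist_eq_norm]
  refine (norm_le_of_rpow_le hr ((hb n w hw1).trans
    ((integral_poisson_mul_le hw1 (hh n) (h0 n)).trans ?_))).trans_lt hn
  have h3 : 0 ≤ ∫ x, h n x ∂mes := integral_nonneg (h0 n)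
  have h4 : 0 < 1 - ρ := by linarith
  gcongr

/-- `H^r(𝕋)` is closed in `L^r(𝕋)`. -/
theorem lrClosure_hardyCircle_le {r : ℝ} (hr : 0 < r) (hr1 : r < 1) :
    lrClosure hr hr1 (hardyCircle hr hr1) ≤ hardyCircle hr hr1 := by
  intro g hg
  have hseq : ∀ n : ℕ, ∃ f ∈ hardyCircle hr hr1, lrDist r g f < (1 / 2 : ℝ) ^ n := fun n =>
    hg _ (by positivity)
  choose f hf hd using hseq
  choose F hF hl using hf
  set h : ℕ → Torus → ℝ := fun n t => ‖g t - f n t‖ ^ r with hdef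
  have hh : ∀ n, Integrable (h n) mes := fun n => integrable_norm_sub_rpow hr g (f n)
  have h0 : ∀ n x, 0 ≤ h n x := fun n x => by positivity
  have hlim : Tendsto (fun n => ∫ x, h n x ∂mes) atTop (𝓝 0) :=
    squeeze_zero (fun n => integral_nonneg (h0 n)) (fun n => (hd n).le)
      (tendsto_pow_atTop_nhds_zero_of_lt_one (by norm_num) (by norm_num))
  have hle : ∀ n m w, ‖w‖ < 1 → ‖F n w - F m w‖ ^ r ≤
      (∫ t, poisson w t * h n t ∂mes) + ∫ t, poisson w t * h m t ∂mes := by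
    intro n m w hw
    have hi : Integrable (fun t => ‖f n t - f m t‖ ^ r) mes :=
      integrable_norm_sub_rpow hr (f n) (f m)
    have hl' : IsRadialLimit (fun z => F n z - F m z) (fun t => f n t - f m t) := by
      filter_upwards [hl n, hl m] with t h1 h2 using h1.sub h2
    have h1 := norm_rpow_le_of_isRadialLimit hr hr1 ((hF n).sub hr hr1 (hF m))
      ((Lp.aestronglyMeasurable (f n)).sub (Lp.aestronglyMeasurable (f m))) hi hl' hw
    refine h1.trans ?_
    rw [← integral_add (integrable_poisson_mul hw (hh n)) (integrable_poisson_mul hw (hh m))]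
    simp only [← mul_add]
    refine integral_poisson_mul_mono hw hi ((hh n).add (hh m)) (Eventually.of_forall fun t => ?_)
    have e : f n t - f m t = (g t - f m t) - (g t - f n t) := by ring
    have h2 := norm_sub_rpow_le hr hr1 (g t - f m t) (g t - f n t)
    simp only [hdef, Pi.sub_apply]
    rw [e]
    linarith
  obtain ⟨G, hGd, hGb⟩ := exists_limit_of_poisson_cauchy hr (fun n => (hF n).1) hh h0 hlim hle
  refine ⟨G, ?_, ?_⟩
  · have hi := integrable_norm_rpow hr (f 0)
    refine memHardyDisc_of_le_poisson hr hGd ((hh 0).add hi) fun w hw => ?_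
    have h1 := hGb 0 w hw
    have h2 := norm_rpow_le_of_isRadialLimit hr hr1 (hF 0) (Lp.aestronglyMeasurable (f 0)) hi
      (hl 0) hw
    have h3 := norm_add_rpow_le hr hr1 (G w - F 0 w) (F 0 w)
    rw [sub_add_cancel] at h3
    simp only [Pi.add_apply, mul_add]
    rw [integral_add (integrable_poisson_mul hw (hh 0)) (integrable_poisson_mul hw hi)]
    linarith
  -- At almost every `t` some `n` has `h n t < η`. Then `G - F n` costs at most `81 η` along the
  -- radius, while `F n - f n t` and `f n t - g t` cost `η` each. The total stays below `100 η = ε ^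
  -- r`.
  · have hae : ∀ᵐ t ∂mes, ∀ n, ∀ η > 0, ∀ᶠ R : ℝ in 𝓝[<] 1,
        ∫ x, poisson (R * unitPt t) x * h n x ∂mes ≤ 80 * h n t + η :=
      ae_all_iff.mpr fun n => ae_eventually_integral_poisson_le (hh n) (h0 n)
    filter_upwards [hae, ae_all_iff.mpr hl, ae_exists_lt_of_tendsto_integral hh h0 hlim]
      with t h1 h2 h3
    rw [Metric.tendsto_nhds]
    intro ε hε
    have hη : 0 < ε ^ r / 100 := by positivity
    obtain ⟨n, hn⟩ := h3 _ hη
    have h4 : Tendsto (fun R : ℝ => ‖F n (R * unitPt t) - f n t‖ ^ r) (𝓝[<] 1) (𝓝 0) := by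
      have := ((h2 n).sub_const (f n t)).norm.rpow_const (p := r) (Or.inr hr.le)
      rwa [sub_self, norm_zero, Real.zero_rpow hr.ne'] at this
    filter_upwards [h1 n _ hη, h4.eventually_lt_const hη, mem_Ico_of_nhdsLT] with R h5 h6 hR
    rw [dist_eq_norm, ← Real.rpow_lt_rpow_iff (norm_nonneg _) hε.le hr]
    have h7 := hGb n (R * unitPt t) (norm_ofReal_mul_lt_one hR (norm_unitPt t).le)
    have e : G (R * unitPt t) - g t = (G (R * unitPt t) - F n (R * unitPt t)) +
      (F n (R * unitPt t) - f n t) - (g t - f n t) := by ring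
    have i1 := norm_sub_rpow_le hr hr1 ((G (R * unitPt t) - F n (R * unitPt t)) +
      (F n (R * unitPt t) - f n t)) (g t - f n t)
    have i2 := norm_add_rpow_le hr hr1 (G (R * unitPt t) - F n (R * unitPt t))
      (F n (R * unitPt t) - f n t)
    rw [e]
    simp only [hdef] at hn h5 h7
    linarith

/-! ### Hitting times, Kac's formula and the constant function in `L^r`. -/

/-- Every forward orbit of an irrational rotation meets a given nonempty open set within a bounded
time. -/
theorem exists_forall_exists_lt_add_nsmul_mem {α : ℝ} (hα : Irrational (α / (2 * Real.pi)))
    {U : Set Torus} (hU : IsOpen U) (hne : U.Nonempty) :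
    ∃ N : ℕ, ∀ x : Torus, ∃ k < N, x + k • (α : Torus) ∈ U := by
  have hd : DenseRange (· • (α : Torus) : ℤ → Torus) :=
    AddCircle.denseRange_zsmul_coe_iff.mpr hα
  have hcov : (Set.univ : Set Torus) ⊆ ⋃ k : ℤ, {x | x + k • (α : Torus) ∈ U} := by
    intro x _
    obtain ⟨k, hk⟩ := hd.exists_mem_open (hU.preimage (continuous_const_add x))
      (by obtain ⟨u, hu⟩ := hne; exact ⟨-x + u, by simpa using hu⟩)
    exact Set.mem_iUnion.mpr ⟨k, hk⟩
  obtain ⟨s, hs⟩ := isCompact_univ.elim_finite_subcover _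
    (fun k => hU.preimage (continuous_add_const (k • (α : Torus)))) hcov
  obtain ⟨M, hM⟩ : ∃ M : ℕ, ∀ k ∈ s, k.natAbs ≤ M :=
    ⟨s.sup Int.natAbs, fun k hk => Finset.le_sup (f := Int.natAbs) hk⟩
  refine ⟨2 * M + 1, fun x => ?_⟩
  -- Compactness gives integer times of absolute value at most `M`. Starting from `x + M • α` shifts
  -- them into `[0, 2 * M]`.
  have hx := hs (Set.mem_univ (x + M • (α : Torus)))
  simp only [Set.mem_iUnion] at hx
  obtain ⟨k, hk, hxk⟩ := hx
  have h1 := hM k hk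
  refine ⟨(M + k).toNat, by omega, ?_⟩
  have h2 : ((M + k).toNat : ℤ) = M + k := Int.toNat_of_nonneg (by omega)
  have h3 : (M + k).toNat • (α : Torus) = M • (α : Torus) + k • (α : Torus) := by
    rw [← natCast_zsmul, h2, add_zsmul, natCast_zsmul]
  rw [h3, ← add_assoc]
  exact hxk

/-- The indicator of the points whose first `k + 1` positions under the rotation by `a` avoid `U`. -/
noncomputable def avoid (U : Set Torus) (a : Torus) (k : ℕ) (x : Torus) : ℝ :=
  ∏ j ∈ Finset.range (k + 1), Uᶜ.indicator 1 (x + j • a)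

theorem avoid_nonneg (U : Set Torus) (a : Torus) (k : ℕ) (x : Torus) : 0 ≤ avoid U a k x :=
  Finset.prod_nonneg fun _ _ => Set.indicator_nonneg (fun _ _ => zero_le_one) _

theorem avoid_zero (U : Set Torus) (a x : Torus) : avoid U a 0 x = Uᶜ.indicator 1 x := by
  simp [avoid]

theorem avoid_succ (U : Set Torus) (a : Torus) (k : ℕ) (x : Torus) :
    avoid U a (k + 1) x = Uᶜ.indicator 1 x * avoid U a k (x + a) := by
  rw [avoid, Finset.prod_range_succ', mul_comm, zero_nsmul, add_zero]
  congr 1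
  refine Finset.prod_congr rfl fun j _ => ?_
  rw [succ_nsmul', add_assoc]

theorem measurable_avoid {U : Set Torus} (hU : MeasurableSet U) (a : Torus) (k : ℕ) :
    Measurable (avoid U a k) := by
  refine Finset.measurable_prod _ fun j _ => ?_
  exact (measurable_one.indicator hU.compl).comp (measurable_id.add_const _)

theorem avoid_eq_zero {U : Set Torus} {a x : Torus} {j k : ℕ} (hj : x + j • a ∈ U) (hjk : j ≤ k) :
    avoid U a k x = 0 :=
  Finset.prod_eq_zero (Finset.mem_range.mpr (Nat.lt_succ_of_le hjk)) (by simp [hj])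

/-- The hitting time of `U`, truncated at `N`. -/
noncomputable def hittingTime (U : Set Torus) (a : Torus) (N : ℕ) (x : Torus) : ℝ :=
  ∑ k ∈ Finset.range N, avoid U a k x

theorem hittingTime_nonneg (U : Set Torus) (a : Torus) (N : ℕ) (x : Torus) :
    0 ≤ hittingTime U a N x := Finset.sum_nonneg fun k _ => avoid_nonneg U a k x

theorem measurable_hittingTime {U : Set Torus} (hU : MeasurableSet U) (a : Torus) (N : ℕ) :
    Measurable (hittingTime U a N) :=
  Finset.measurable_sum _ fun k _ => measurable_avoid hU a k

theorem avoid_le_one (U : Set Torus) (a : Torus) (k : ℕ) (x : Torus) : avoid U a k x ≤ 1 :=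
  Finset.prod_le_one (fun _ _ => Set.indicator_nonneg (fun _ _ => zero_le_one) _)
    fun _ _ => Set.indicator_apply_le' (fun _ => le_rfl) fun _ => zero_le_one

theorem hittingTime_le (U : Set Torus) (a : Torus) (N : ℕ) (x : Torus) :
    hittingTime U a N x ≤ N := by
  calc _ ≤ ∑ k ∈ Finset.range N, (1 : ℝ) := Finset.sum_le_sum fun k _ => avoid_le_one U a k x
    _ = N := by simp

/-- As every orbit hits `U` before time `N`, the truncation loses nothing: the hitting time is zero
on `U` and drops by one at each step outside. -/
theorem hittingTime_eq {U : Set Torus} {a : Torus} {N : ℕ}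
    (hN : ∀ x : Torus, ∃ k < N, x + k • a ∈ U) (x : Torus) :
    hittingTime U a N x = Uᶜ.indicator 1 x * (1 + hittingTime U a N (x + a)) := by
  have hlast : avoid U a N x = 0 := by
    obtain ⟨k, hk, hx⟩ := hN x
    exact avoid_eq_zero hx hk.le
  have h1 : hittingTime U a N x = ∑ k ∈ Finset.range (N + 1), avoid U a k x := by
    rw [Finset.sum_range_succ, hlast, add_zero, hittingTime]
  rw [h1, Finset.sum_range_succ', avoid_zero, mul_add, mul_one, hittingTime, Finset.mul_sum,
    add_comm]
  congr 1
  exact Finset.sum_congr rfl fun k _ => avoid_succ U a k x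

theorem integrable_hittingTime {U : Set Torus} (hU : MeasurableSet U) (a : Torus) (N : ℕ) :
    Integrable (hittingTime U a N) mes :=
  (integrable_const (N : ℝ)).mono' (measurable_hittingTime hU a N).aestronglyMeasurable
    (Eventually.of_forall fun x => by
      rw [Real.norm_of_nonneg (hittingTime_nonneg U a N x)]; exact hittingTime_le U a N x)

/-- Kac's formula: the return time to `U` has integral one over `U`. -/
theorem integral_returnTime {U : Set Torus} (hU : MeasurableSet U) {a : Torus} {N : ℕ}
    (hN : ∀ x : Torus, ∃ k < N, x + k • a ∈ U) :
    ∫ x in U, (1 + hittingTime U a N (x + a)) ∂mes = 1 := by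
  have hi := integrable_hittingTime hU a N
  have hi' : Integrable (fun x => hittingTime U a N (x + a)) mes := hi.comp_add_right a
  have hi₁ : Integrable (fun x => 1 + hittingTime U a N (x + a)) mes := (integrable_const 1).add hi'
  -- The return time on `U`, extended by zero, is one plus a coboundary; by invariance of the
  -- measure the coboundary integrates to zero.
  have h1 : ∀ x, U.indicator (fun x => 1 + hittingTime U a N (x + a)) x =
      1 + hittingTime U a N (x + a) - hittingTime U a N x := by
    intro x
    rw [hittingTime_eq hN x]
    by_cases hx : x ∈ U <;> simp [hx]
  rw [← integral_indicator hU, integral_congr_ae (Eventually.of_forall h1),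
    integral_sub hi₁ hi, integral_add (integrable_const _) hi',
    integral_add_right_eq_self (μ := mes) (hittingTime U a N) a]
  simp

/-- For `x ≥ 0` and `M > 0`, the power `x ^ r` lies below a linear function of `x`. -/
theorem rpow_le_add_mul {r : ℝ} (hr1 : r < 1) {x M : ℝ} (hx : 0 < x) (hM : 0 < M)
    (hr : 0 < r) : x ^ r ≤ M ^ r + M ^ (r - 1) * x := by
  rcases le_total x M with h | h
  · have h1 : x ^ r ≤ M ^ r := Real.rpow_le_rpow hx.le h hr.le
    have h2 : 0 ≤ M ^ (r - 1) * x := by positivity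
    linarith
  · have h1 : x ^ r = x ^ (r - 1) * x := by
      rw [← Real.rpow_add_one hx.ne', sub_add_cancel]
    have h2 : x ^ (r - 1) ≤ M ^ (r - 1) := Real.rpow_le_rpow_of_nonpos hM h (by linarith)
    have h3 : 0 ≤ M ^ r := by positivity
    rw [h1]
    nlinarith

theorem measureReal_ball_le (t : Torus) {ρ : ℝ} (hρ : 0 < ρ) :
    mes.real (Metric.ball t ρ) ≤ ρ := by
  have hv : (volume : Measure Torus) = ENNReal.ofReal (2 * Real.pi) • mes :=
    AddCircle.volume_eq_smul_haarAddCircle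
  have h4 : (volume : Measure Torus).real (Metric.closedBall t ρ) ≤ 2 * ρ := by
    rw [measureReal_def, AddCircle.volume_closedBall]
    rw [ENNReal.toReal_ofReal (le_min Real.two_pi_pos.le (by linarith))]
    exact min_le_right _ _
  have h5 : mes.real (Metric.ball t ρ) ≤ mes.real (Metric.closedBall t ρ) :=
    measureReal_mono Metric.ball_subset_closedBall
  rw [hv, measureReal_ennreal_smul_apply, ENNReal.toReal_ofReal Real.two_pi_pos.le] at h4
  have h6 : 0 ≤ mes.real (Metric.closedBall t ρ) := measureReal_nonneg
  nlinarith [Real.pi_gt_three]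

/-- For every exponent below one the constant function is a limit of coboundaries. -/
theorem one_mem_lrClosure_coboundaries_top {r : ℝ} (hr : 0 < r) (hr1 : r < 1) {α : ℝ}
    (hα : Irrational (α / (2 * Real.pi))) :
    Lp.const (ENNReal.ofReal r) mes (1 : ℂ) ∈ lrClosure hr hr1 (coboundaries r α ⊤) := by
  intro ε hε
  -- The order of choices matters. By Kac's formula the linear part of `rpow_le_add_mul` contributes
  -- exactly `M ^ (r - 1)`, whatever `U` is; then `ρ` is chosen so small that the constant part
  -- contributes at most `ρ * M ^ r = ε / 2`.
  obtain ⟨M, hM0, hM⟩ : ∃ M : ℝ, 0 < M ∧ M ^ (r - 1) < ε / 2 := by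
    have h1 := tendsto_rpow_neg_atTop (show 0 < 1 - r by linarith)
    obtain ⟨M, h2, h3⟩ := ((h1.eventually_lt_const (half_pos hε)).and (eventually_gt_atTop 0)).exists
    exact ⟨M, h3, by rwa [neg_sub] at h2⟩
  set ρ := ε / (2 * M ^ r) with hρdef
  have hρ : 0 < ρ := by positivity
  set U : Set Torus := Metric.ball 0 ρ with hUdef
  have hUm : MeasurableSet U := Metric.isOpen_ball.measurableSet
  obtain ⟨N, hN⟩ := exists_forall_exists_lt_add_nsmul_mem hα (U := U) Metric.isOpen_ball
    ⟨0, Metric.mem_ball_self hρ⟩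
  set a : Torus := (α : Torus) with ha
  set n := hittingTime U a N with hn
  have hnm : MemLp (fun x => (n x : ℂ)) (ENNReal.ofReal r) mes := by
    refine MemLp.of_bound (Complex.measurable_ofReal.comp
      (measurable_hittingTime hUm a N)).aestronglyMeasurable N (Eventually.of_forall fun x => ?_)
    rw [Complex.norm_real, Real.norm_of_nonneg (hittingTime_nonneg U a N x)]
    exact hittingTime_le U a N x
  refine ⟨_, ⟨hnm.toLp _, trivial, rfl⟩, ?_⟩
  change lrDist r _ (hnm.toLp _ - rotOp r α (hnm.toLp _)) < ε
  have hτ0 : ∀ x, 0 < 1 + n (x + a) := fun x => by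
    have := hittingTime_nonneg U a N (x + a); positivity
  have hτi : Integrable (fun x => 1 + n (x + a)) mes :=
    (integrable_const _).add ((integrable_hittingTime hUm a N).comp_add_right a)
  have hdist : lrDist r (Lp.const (ENNReal.ofReal r) mes (1 : ℂ))
      (hnm.toLp _ - rotOp r α (hnm.toLp _)) ≤
      ∫ x, U.indicator (fun x => M ^ r + M ^ (r - 1) * (1 + n (x + a))) x ∂mes := by
    refine integral_mono_ae (integrable_norm_sub_rpow hr _ _)
      (((integrable_const _).add (hτi.const_mul _)).indicator hUm) ?_
    filter_upwards [Lp.coeFn_const (ENNReal.ofReal r) mes (1 : ℂ), hnm.coeFn_toLp,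
      (measurePreserving_add_right mes a).quasiMeasurePreserving.ae hnm.coeFn_toLp,
      coeFn_rotOp r α (hnm.toLp _), Lp.coeFn_sub (hnm.toLp _) (rotOp r α (hnm.toLp _))]
      with x h1 h2 h3 h4 h5
    rw [h1, h5, Pi.sub_apply, h4, h2, h3, Function.const_apply]
    have h6 : (1 : ℂ) - ((n x : ℂ) - (n (x + a) : ℂ)) = ((1 + n (x + a) - n x : ℝ) : ℂ) := by
      push_cast; ring
    rw [h6, Complex.norm_real, hn, hittingTime_eq hN x, ← hn]
    by_cases hx : x ∈ U
    · simp only [hx, Set.indicator_of_mem, Set.indicator_of_notMem, Set.mem_compl_iff,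
        not_true_eq_false, not_false_eq_true, zero_mul, sub_zero]
      rw [Real.norm_of_nonneg (hτ0 x).le]
      exact rpow_le_add_mul hr1 (hτ0 x) hM0 hr
    · simp [hx, Real.zero_rpow hr.ne']
  refine hdist.trans_lt ?_
  rw [integral_indicator hUm, integral_add (integrable_const _) (hτi.const_mul _).integrableOn,
    setIntegral_const, integral_const_mul, integral_returnTime hUm hN, mul_one, smul_eq_mul]
  have h7 : mes.real U * M ^ r ≤ ρ * M ^ r := by
    gcongr
    exact measureReal_ball_le 0 hρ
  have h8 : ρ * M ^ r = ε / 2 := by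
    rw [hρdef]; field_simp
  linarith

end HardyRotation

theorem theorem3p1 (r : ℝ) (hr : 0 < r) (hr1 : r < 1) (α : ℝ)
    (hα : Irrational (α / (2 * Real.pi))) :
    -- `H^r(𝕋)` is the sum of the constants and the closure of `(I - T) H^r(𝕋)` ...
    HardyRotation.constants r ⊔
        HardyRotation.lrClosure hr hr1
          (HardyRotation.coboundaries r α (HardyRotation.hardyCircle hr hr1)) =
      HardyRotation.hardyCircle hr hr1 ∧
    -- ... and the sum is direct;
    Disjoint (HardyRotation.constants r)
      (HardyRotation.lrClosure hr hr1
        (HardyRotation.coboundaries r α (HardyRotation.hardyCircle hr hr1))) ∧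
    -- in particular the constant function `1` is not in that closure,
    MeasureTheory.Lp.const (ENNReal.ofReal r) HardyRotation.mes (1 : ℂ) ∉
      HardyRotation.lrClosure hr hr1
        (HardyRotation.coboundaries r α (HardyRotation.hardyCircle hr hr1)) ∧
    -- whereas for `r < 1/3` it is in the closure of `(I - T) L^r(𝕋)`.
    (r < 1 / 3 →
      MeasureTheory.Lp.const (ENNReal.ofReal r) HardyRotation.mes (1 : ℂ) ∈
        HardyRotation.lrClosure hr hr1 (HardyRotation.coboundaries r α ⊤)) := by
  refine ⟨le_antisymm (sup_le ?_ ?_) ?_, ?_, ?_, fun _ =>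
    HardyRotation.one_mem_lrClosure_coboundaries_top hr hr1 hα⟩
  · rintro _ ⟨c, rfl⟩
    exact HardyRotation.const_mem_hardyCircle hr hr1 c
  · intro g hg
    refine HardyRotation.lrClosure_hardyCircle_le hr hr1 fun ε hε => ?_
    obtain ⟨f, hf, hd⟩ := hg ε hε
    exact ⟨f, HardyRotation.coboundaries_le_hardyCircle hr hr1 α hf, hd⟩
  · rintro g ⟨F, hF, hl⟩
    rw [← add_sub_cancel (MeasureTheory.Lp.const (ENNReal.ofReal r) HardyRotation.mes (F 0)) g]
    exact Submodule.add_mem_sup ⟨F 0, rfl⟩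
      (HardyRotation.sub_const_mem_lrClosure hr hr1 hα hF hl)
  · rw [Submodule.disjoint_def]
    rintro _ ⟨c, rfl⟩ hc
    rw [HardyRotation.eq_zero_of_const_mem_lrClosure hr hr1 hc, map_zero]
  · intro h
    exact one_ne_zero (HardyRotation.eq_zero_of_const_mem_lrClosure hr hr1 h)
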